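/- **Lemma (Refined bilinear estimates).** Notation. For $m\ge 0$ and $\xi\in\mathbb R^3$ let $\langle\xi\rangle_m=\sqrt{m^2+|\xi|^2}$, and let $S_m(\pm t)=e^{\mp it\langle D\rangle_m}$ be the free propagators on $L^2(\mathbb R^3;\mathbb C)$, where $D=-i\nabla$ and $\sigma(D)$ denotes the Fourier multiplier $\widehat{\sigma(D)f}(\xi)=\sigma(\xi)\widehat f(\xi)$, with $\widehat f(\xi)=\int_{\mathbb R^3} e^{-ix\cdot\xi}f(x)\,dx$. Fix an even real-valued $\chi\in C_0^\infty((-2,2))$ with $\chi(s)=1$ for $|s|\le1$. For dyadic $\lambda>0$ (that is, $\lambda=2^k$ with $k\in\mathbb Z$) put $\rho_\lambda=0$ if $\lambda<1$, $\rho_1(s)=\chi(s)$, and $\rho_\lambda(s)=\chi(s/\lambda)-\chi(2s/\lambda)$ if $\lambda>1$, and let $P_\lambda=\rho_\lambda(|D|)$. For dyadic $\mu>0$ and $z\in\mathbb Z^3$ let $C_z=\mu z+[0,\mu)^3$ and $P_{C_z}=\mathbb 1_{C_z}(D)$. For $f,g\in L^2(\mathbb R^3)$ and dyadic $\mu,\lambda_1,\lambda_2>0$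 put $f_{z,\lambda_1}=P_{C_z}P_{\lambda_1}f$ and $g_{z',\lambda_2}=P_{C_{z'}}P_{\lambda_2}g$. On the left-hand sides below $\|\cdot\|$ is the norm of $L^2_{t,x}(\mathbb R^{1+3})$, on the right-hand sides that of $L^2_x(\mathbb R^3)$. Statement. There is an absolute constant $N>1$ such that for every $\chi$ as above, every $m\ge0$ and every $K\ge1$ there is a constant $C>0$, depending only on $\chi$, $m$ and $K$, with the following property. For all dyadic $\mu,\lambda_1,\lambda_2>0$ with $N\mu\le\lambda_1$ (i.e. $\mu\ll\lambda_1$) and $K^{-1}\lambda_1\le\lambda_2\le K\lambda_1$ (i.e. $\lambda_1\sim\lambda_2$), all $(z,z')\in\mathbb Z^3\times\mathbb Z^3$ and all $f,g\in L^2(\mathbb R^3)$, the functions on the left below belong to $L^2_{t,x}(\mathbb R^{1+3})$ and: (i) (++) interaction: $$\big\|P_\mu\big(S_m(t)f_{z,\lambda_1}\cdot S_m(t)g_{z',\lambda_2}\big)\big\|\le C\,\mu\,\|f_{z,\lambda_1}\|\,\|g_{z',\lambda_2}\|;$$ (ii) (+−) interaction: $$\big\|P_\mu\big(S_m(t)f_{z,\lambda_1}\cdot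 S_m(-t)g_{z',\lambda_2}\big)\big\|\le C\,(\mu\lambda_1)^{1/2}\,\|f_{z,\lambda_1}\|\,\|g_{z',\lambda_2}\|.$$ -/

import Mathlib

open MeasureTheory
open scoped FourierTransform ContDiff ENNReal

noncomputable section

namespace DiracBilinear

/-- The physical (and frequency) space `ℝ³`, with the Euclidean norm and Lebesgue measure. -/
abbrev R3 : Type := EuclideanSpace ℝ (Fin 3)

/-- The complex Hilbert space `L²(ℝ³)`. -/
abbrev L2 : Type := Lp ℂ 2 (volume : Measure R3)

/-- An even function `χ ∈ C₀^∞((-2, 2))` with `χ(s) = 1` for `|s| ≤ 1`. -/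
structure Cutoff where
  /-- the underlying function -/
  toFun : ℝ → ℝ
  smooth : ContDiff ℝ ∞ toFun
  even : ∀ s, toFun (-s) = toFun s
  support : tsupport toFun ⊆ Set.Ioo (-2) 2
  eq_one : ∀ s, |s| ≤ 1 → toFun s = 1

/-- `μ` is dyadic: `μ = 2^k` for some integer `k`. -/
def IsDyadic (μ : ℝ) : Prop := ∃ k : ℤ, μ = (2 : ℝ) ^ k

/-- The (inhomogeneous) Littlewood-Paley symbol `ρ_l`, for dyadic `l > 0`. -/
def rho (χ : Cutoff) (l s : ℝ) : ℝ :=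
  if l < 1 then 0
  else if l = 1 then χ.toFun s
  else χ.toFun (s / l) - χ.toFun (2 * s / l)

/-- The Japanese bracket `⟨ξ⟩_m = √(m² + |ξ|²)`. -/
def jap (m : ℝ) (ξ : R3) : ℝ := Real.sqrt (m ^ 2 + ‖ξ‖ ^ 2)

/-- The cube `C_z = μ z + [0, μ)³`. -/
def cube (μ : ℝ) (z : Fin 3 → ℤ) : Set R3 :=
  {ξ | ∀ i, μ * z i ≤ ξ i ∧ ξ i < μ * z i + μ}

/-- A bounded measurable symbol, rescaled, multiplies `L²` into itself. -/
theorem memLp_symbol_mul {σ : R3 → ℂ} (hσ : Measurable σ) (hb : ∃ C, ∀ ξ, ‖σ ξ‖ ≤ C) (F : L2) :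
    MemLp (fun ξ => σ ((2 * Real.pi) • ξ) * F ξ) 2 volume := by
  obtain ⟨C, hC⟩ := hb
  refine MemLp.of_le_mul (c := C) (Lp.memLp F) ?_ (Filter.Eventually.of_forall fun ξ => ?_)
  · exact (hσ.comp (measurable_const_smul _)).aestronglyMeasurable.mul
      (Lp.memLp F).aestronglyMeasurable
  · rw [norm_mul]
    exact mul_le_mul_of_nonneg_right (hC _) (norm_nonneg _)

/-- The Fourier multiplier `σ(D)` on `L²(ℝ³)` with bounded measurable symbol `σ`, where
`D = -i∇`, so that `(σ(D) f)^ = σ f^` for the Fourier transform `∫ e^{-i x·ξ} f(x) dx`.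
Mathlib's transform `𝓕` has the kernel `e^{-2πi x·ξ}`, hence the argument `2πξ` of `σ`. -/
def multiplier (σ : R3 → ℂ) (hσ : Measurable σ) (hb : ∃ C, ∀ ξ, ‖σ ξ‖ ≤ C) (f : L2) : L2 :=
  𝓕⁻ ((memLp_symbol_mul hσ hb (𝓕 f)).toLp (fun ξ => σ ((2 * Real.pi) • ξ) * (𝓕 f : L2) ξ))

theorem Cutoff.exists_bound (χ : Cutoff) : ∃ C, ∀ s, |χ.toFun s| ≤ C := by
  have hc : HasCompactSupport χ.toFun :=
    (isCompact_Icc (a := (-2 : ℝ)) (b := 2)).of_isClosed_subset (isClosed_tsupport _)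
      (χ.support.trans Set.Ioo_subset_Icc_self)
  simpa [Real.norm_eq_abs] using hc.exists_bound_of_continuous χ.smooth.continuous

theorem rho_continuous (χ : Cutoff) (l : ℝ) : Continuous (rho χ l) := by
  have h := χ.smooth.continuous
  unfold rho
  split_ifs <;> fun_prop

theorem measurable_rho_symbol (χ : Cutoff) (l : ℝ) :
    Measurable fun ξ : R3 => ((rho χ l ‖ξ‖ : ℝ) : ℂ) :=
  (Complex.continuous_ofReal.comp ((rho_continuous χ l).comp continuous_norm)).measurable

theorem bound_rho_symbol (χ : Cutoff) (l : ℝ) :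
    ∃ C, ∀ ξ : R3, ‖((rho χ l ‖ξ‖ : ℝ) : ℂ)‖ ≤ C := by
  obtain ⟨C, hC⟩ := χ.exists_bound
  have h0 : 0 ≤ C := (abs_nonneg _).trans (hC 0)
  refine ⟨C + C, fun ξ => ?_⟩
  rw [Complex.norm_real, Real.norm_eq_abs]
  unfold rho
  split_ifs
  · simpa using h0
  · linarith [hC ‖ξ‖]
  · exact (abs_sub _ _).trans (add_le_add (hC _) (hC _))

/-- The frequency projection `P_l = ρ_l(|D|)` on `L²(ℝ³)`. -/
def freqProj (χ : Cutoff) (l : ℝ) : L2 → L2 :=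
  multiplier (fun ξ => ((rho χ l ‖ξ‖ : ℝ) : ℂ)) (measurable_rho_symbol χ l) (bound_rho_symbol χ l)

theorem measurableSet_cube (μ : ℝ) (z : Fin 3 → ℤ) : MeasurableSet (cube μ z) := by
  unfold cube
  measurability

/-- The frequency projection `P_{C_z}` onto the cube `C_z`, on `L²(ℝ³)`. -/
def cubeProj (μ : ℝ) (z : Fin 3 → ℤ) : L2 → L2 :=
  multiplier ((cube μ z).indicator fun _ => (1 : ℂ))
    (measurable_const.indicator (measurableSet_cube μ z))
    ⟨1, fun ξ => by
      simpa using norm_indicator_le_norm_self (s := cube μ z) (fun _ => (1 : ℂ)) ξ⟩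

theorem measurable_prop_symbol (m t : ℝ) :
    Measurable fun ξ : R3 => Complex.exp (-Complex.I * ((t * jap m ξ : ℝ) : ℂ)) := by
  unfold jap
  fun_prop

theorem bound_prop_symbol (m t : ℝ) :
    ∃ C, ∀ ξ : R3, ‖Complex.exp (-Complex.I * ((t * jap m ξ : ℝ) : ℂ))‖ ≤ C :=
  ⟨1, fun ξ => by simp [Complex.norm_exp]⟩

/-- The free propagator `S_m(t) = e^{-i t ⟨D⟩_m}` on `L²(ℝ³)`, for every real `t`; in particular
`S_m(-t) = e^{i t ⟨D⟩_m}`. -/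
def propagator (m t : ℝ) : L2 → L2 :=
  multiplier (fun ξ => Complex.exp (-Complex.I * ((t * jap m ξ : ℝ) : ℂ)))
    (measurable_prop_symbol m t) (bound_prop_symbol m t)

/-- The frequency projection `P_μ w = F⁻¹[ρ_μ(|ξ|) F w]` of an integrable function `w`, as a
pointwise defined function. It is applied to products of two `L²` functions, which are integrable:
then `F w` is the classical Fourier integral, and as `ρ_μ` is bounded with bounded support, the
inverse Fourier integral converges absolutely. -/
def freqProjL1 (χ : Cutoff) (μ : ℝ) (w : R3 → ℂ) : R3 → ℂ :=
  𝓕⁻ (fun ξ : R3 => ((rho χ μ ‖(2 * Real.pi) • ξ‖ : ℝ) : ℂ) * 𝓕 w ξ)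

/-- The frequency-localized function `f_{z,l} = P_{C_z} P_l f`, where `C_z` is the cube of
side `μ`. -/
def localized (χ : Cutoff) (μ l : ℝ) (z : Fin 3 → ℤ) (f : L2) : L2 :=
  cubeProj μ z (freqProj χ l f)

/-- The function `(t, x) ↦ P_μ (S_m(t) f · S_m(ε t) g)(x)` on `ℝ^{1+3}`; `ε = 1` is the (++)
interaction and `ε = -1` is the (+-) interaction. -/
def interaction (χ : Cutoff) (m μ ε : ℝ) (f g : L2) : ℝ × R3 → ℂ := fun p =>
  freqProjL1 χ μ (fun x => propagator m p.1 f x * propagator m (ε * p.1) g x) p.2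

end DiracBilinear

end

noncomputable section

namespace DiracBilinear

/-! ### Fourier analysis on `L²`: products as convolutions, Plancherel on `L¹ ∩ L²` -/

section Fourier

variable {V : Type*} [NormedAddCommGroup V] [InnerProductSpace ℝ V] [FiniteDimensional ℝ V]
  [MeasurableSpace V] [BorelSpace V]

/-! At output frequency `ξ` the spatial Fourier transform of `S_m(t)f · S_m(±t)g` is the oscillatory
integral of `e^{-itΦ}` against `f^(η) g^(ξ-η)`, with phase `Φ = ⟨η⟩ ± ⟨ξ-η⟩`. Plancherel in `x`,
then an `L²` bound in `t`, reduces everything to the geometry of `Φ`: if for every relevant `ξ` the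
part of `{x < Φ < y}` lying in the frequency support of `f` has volume at most `M (y - x)`, the
squared space-time norm is at most `2πM ‖f‖² ‖g‖²` (`lintegral_oscIntegral_sq_le`,
`lintegral_bilinear_oscIntegral_le`).

The level sets of the sum `⟨η⟩ + ⟨ξ-η⟩` in a cube of side `μ` at distance about `λ ≫ μ` from the
origin are controlled in two ways. If `|ξ| ≲ μ`, both brackets are monotone in the same direction
along a dominant coordinate of `η`, with slope bounded below; the other two coordinates contribute
`μ²`, so `M ~ μ²` (`volume_level_transversal_le`). For arbitrary `ξ`, once the dominant coordinate
is fixed, `⟨η⟩` is strongly convex in the other two with modulus about `1/λ` and `⟨ξ-η⟩` is convex;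
planar slices of the level set have area `≲ λ(y - x)`, so `M ~ μλ` (`volume_level_curved_le`).

The first bound is the (++) estimate, since `P_μ` forces `|ξ| ≲ μ`. The (+−) phase is never analysed
directly: `‖uv‖² ≤ ‖u²‖ ‖v²‖`, and each square is a (++) product (for `v` after `t ↦ -t`) to which
the second bound applies. -/

theorem schwartz_fourier_mul (f g : SchwartzMap V ℂ) (ξ : V) :
    𝓕 (fun x => f x * g x) ξ = ∫ η, (𝓕 f : SchwartzMap V ℂ) η * (𝓕 g : SchwartzMap V ℂ) (ξ - η) := by
  -- A product is the transform of a convolution of inverse transforms; evaluating at `-ξ` exchanges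
  -- `𝓕⁻` and `𝓕`.
  have h := SchwartzMap.convolution_apply (ContinuousLinearMap.mul ℂ ℂ) (𝓕⁻ f) (𝓕⁻ g) (-ξ)
  have h1 : 𝓕 (fun x => f x * g x) ξ =
      (SchwartzMap.convolution (ContinuousLinearMap.mul ℂ ℂ) (𝓕⁻ f) (𝓕⁻ g)) (-ξ) := by
    have h2 : SchwartzMap.convolution (ContinuousLinearMap.mul ℂ ℂ) (𝓕⁻ f) (𝓕⁻ g) =
        𝓕⁻ (SchwartzMap.pairing (ContinuousLinearMap.mul ℂ ℂ) f g) := by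
      simp [SchwartzMap.convolution]
    rw [h2, SchwartzMap.fourierInv_coe, Real.fourierInv_eq_fourier_neg, neg_neg]
    congr 1
  rw [h1, h, MeasureTheory.convolution_def, ← integral_neg_eq_self]
  refine integral_congr_ae (Filter.Eventually.of_forall fun η => ?_)
  simp only [ContinuousLinearMap.mul_apply']
  rw [SchwartzMap.fourierInv_coe, SchwartzMap.fourierInv_coe, Real.fourierInv_eq_fourier_neg,
    Real.fourierInv_eq_fourier_neg, SchwartzMap.fourier_coe, SchwartzMap.fourier_coe]
  congr 2
  · rw [neg_neg]
  · rw [show -(-ξ - -η) = ξ - η by abel]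

theorem measurePreserving_sub_left_volume (ξ : V) :
    MeasurePreserving (fun η : V => ξ - η) volume volume :=
  Measure.measurePreserving_sub_left volume ξ

/-- The Fourier transform of a product of two `L²` functions is the convolution of their Fourier
transforms, at every point. -/
theorem fourier_mul_eq_convolution (u v : Lp ℂ 2 (volume : Measure V)) (ξ : V) :
    𝓕 (fun x => u x * v x) ξ =
      ∫ η, (𝓕 u : Lp ℂ 2 (volume : Measure V)) η * (𝓕 v : Lp ℂ 2 (volume : Measure V)) (ξ - η) := by
  have hd := SchwartzMap.denseRange_toLpCLM (F := ℂ) (μ := (volume : Measure V)) (p := 2)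
    ENNReal.ofNat_ne_top
  let B := ContinuousLinearMap.mul ℂ ℂ
  -- At a fixed `ξ` both sides are continuous bilinear forms on `L² × L²`: on the left the character
  -- is a bounded multiplier, on the right `η ↦ ξ - η` preserves the measure. Density of Schwartz
  -- functions then suffices.
  have he : MemLp (fun x : V => ((Real.fourierChar (-inner ℝ x ξ) : Circle) : ℂ)) ∞ volume := by
    refine memLp_top_of_bound (C := 1) ?_ (Filter.Eventually.of_forall fun x => (Circle.norm_coe _).le)
    exact (Continuous.aestronglyMeasurable (by fun_prop))
  let e : Lp ℂ ∞ (volume : Measure V) := he.toLp _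
  have hleft : ∀ u v : Lp ℂ 2 (volume : Measure V), 𝓕 (fun x => u x * v x) ξ =
      B.lpPairing volume 2 2 u (B.holderL volume ∞ 2 2 e v) := by
    intro u v
    rw [ContinuousLinearMap.lpPairing_eq_integral, Real.fourier_eq]
    refine integral_congr_ae ?_
    filter_upwards [he.coeFn_toLp, B.coeFn_holder (r := 2) e v] with x hx hx'
    rw [ContinuousLinearMap.holderL_apply_apply, hx', hx]
    simp only [B, ContinuousLinearMap.mul_apply', Circle.smul_def, smul_eq_mul]
    ring
  have hright : ∀ u v : Lp ℂ 2 (volume : Measure V),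
      ∫ η, (𝓕 u : Lp ℂ 2 (volume : Measure V)) η * (𝓕 v : Lp ℂ 2 (volume : Measure V)) (ξ - η) =
      B.lpPairing volume 2 2 (𝓕 u)
        (Lp.compMeasurePreserving _ (measurePreserving_sub_left_volume ξ) (𝓕 v)) := by
    intro u v
    rw [ContinuousLinearMap.lpPairing_eq_integral]
    refine integral_congr_ae ?_
    filter_upwards [Lp.coeFn_compMeasurePreserving (𝓕 v : Lp ℂ 2 (volume : Measure V))
      (measurePreserving_sub_left_volume ξ)] with x hx
    rw [hx]
    simp [B]
  refine hd.induction_on₂ (p := fun u v : Lp ℂ 2 (volume : Measure V) =>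
    𝓕 (fun x => u x * v x) ξ = ∫ η, (𝓕 u : Lp ℂ 2 (volume : Measure V)) η *
      (𝓕 v : Lp ℂ 2 (volume : Measure V)) (ξ - η)) ?_ ?_ u v
  · simp_rw [hleft, hright]
    refine isClosed_eq ?_ ?_
    · exact ((B.lpPairing volume 2 2).continuous.comp continuous_fst).clm_apply
        ((B.holderL volume ∞ 2 2 e).continuous.comp continuous_snd)
    · refine ((B.lpPairing volume 2 2).continuous.comp
        ((Lp.fourierTransformₗᵢ V ℂ).continuous.comp continuous_fst)).clm_apply ?_
      exact (Lp.isometry_compMeasurePreserving (measurePreserving_sub_left_volume ξ)).continuous.comp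
        ((Lp.fourierTransformₗᵢ V ℂ).continuous.comp continuous_snd)
  · intro f g
    simp only [SchwartzMap.toLpCLM_apply]
    have h := schwartz_fourier_mul f g ξ
    rw [SchwartzMap.toLp_fourier_eq, SchwartzMap.toLp_fourier_eq]
    have h1 := f.coeFn_toLp 2 (volume : Measure V)
    have h2 := g.coeFn_toLp 2 (volume : Measure V)
    have h3 := (𝓕 f : SchwartzMap V ℂ).coeFn_toLp 2 (volume : Measure V)
    have h4 := (𝓕 g : SchwartzMap V ℂ).coeFn_toLp 2 (volume : Measure V)
    calc _ = 𝓕 (fun x => f x * g x) ξ := by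
          rw [Real.fourier_eq, Real.fourier_eq]
          refine integral_congr_ae ?_
          filter_upwards [h1, h2] with x hx hx'
          rw [hx, hx']
      _ = _ := h
      _ = _ := by
          refine integral_congr_ae ?_
          filter_upwards [h3,
            (measurePreserving_sub_left_volume ξ).quasiMeasurePreserving.ae_eq_comp h4] with x hx hx'
          simp only [Function.comp_apply] at hx'
          rw [hx, hx']

/-- On `L¹ ∩ L²` the `L²` Fourier transform is the Fourier integral. -/
theorem coeFn_fourier_toLp {f : V → ℂ} (h1 : Integrable f) (h2 : MemLp f 2 volume) :
    (𝓕 (h2.toLp f) : Lp ℂ 2 (volume : Measure V)) =ᵐ[volume] 𝓕 f := by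
  have hcont : Continuous (𝓕 f) :=
    VectorFourier.fourierIntegral_continuous Real.continuous_fourierChar
      (by exact continuous_inner) h1
  -- Test against smooth compactly supported `g` and move the transform onto `g`: by duality of
  -- tempered distributions for the `L²` transform, by Fubini for the Fourier integral.
  refine ae_eq_of_integral_contDiff_smul_eq
    ((Lp.memLp _).locallyIntegrable (by norm_num)) hcont.locallyIntegrable fun g hg hgs => ?_
  let G : SchwartzMap V ℂ := HasCompactSupport.toSchwartzMap (f := fun x => (g x : ℂ))
    (hgs.comp_left (g := fun r : ℝ => (r : ℂ)) (by simp)) (Complex.ofRealCLM.contDiff.comp hg)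
  have hG : ∀ x, G x = (g x : ℂ) := fun x => rfl
  have h := congrArg (fun T => T G) (Lp.fourier_toTemperedDistribution_eq (h2.toLp f))
  simp only [TemperedDistribution.fourier_apply, Lp.toTemperedDistribution_apply] at h
  have hflip := VectorFourier.integral_fourierIntegral_smul_eq_flip (μ := (volume : Measure V))
    (ν := (volume : Measure V)) (L := innerₗ V) (f := fun x => G x) (g := f)
    Real.continuous_fourierChar (by exact continuous_inner) G.integrable h1
  calc ∫ x, g x • (𝓕 (h2.toLp f) : Lp ℂ 2 (volume : Measure V)) x
      = ∫ x, G x • (𝓕 (h2.toLp f) : Lp ℂ 2 (volume : Measure V)) x := by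
        simp only [hG, smul_eq_mul, Complex.real_smul]
    _ = ∫ x, (𝓕 G : SchwartzMap V ℂ) x • (h2.toLp f) x := h.symm
    _ = ∫ x, (𝓕 G : SchwartzMap V ℂ) x • f x := by
        refine integral_congr_ae ?_
        filter_upwards [h2.coeFn_toLp] with x hx
        rw [hx]
    _ = ∫ x, G x • 𝓕 f x := by
        rw [flip_innerₗ] at hflip
        exact hflip
    _ = _ := by simp only [hG, smul_eq_mul, Complex.real_smul]

/-- **Plancherel's theorem** for the Fourier integral on `L¹ ∩ L²`. -/
theorem eLpNorm_fourier {f : V → ℂ} (h1 : Integrable f) (h2 : MemLp f 2 volume) :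
    eLpNorm (𝓕 f) 2 volume = eLpNorm f 2 volume := by
  rw [← eLpNorm_congr_ae (coeFn_fourier_toLp h1 h2), ← eLpNorm_congr_ae h2.coeFn_toLp,
    ← Lp.enorm_def, ← Lp.enorm_def, ← ofReal_norm, ← ofReal_norm, Lp.norm_fourier_eq]

theorem continuous_fourier {f : V → ℂ} (h1 : Integrable f) : Continuous (𝓕 f) :=
  VectorFourier.fourierIntegral_continuous Real.continuous_fourierChar
    (by exact continuous_inner) h1

theorem eLpNorm_fourierInv {f : V → ℂ} (h1 : Integrable f) (h2 : MemLp f 2 volume) :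
    eLpNorm (𝓕⁻ f) 2 volume = eLpNorm f 2 volume := by
  rw [← eLpNorm_fourier h1 h2]
  have : (𝓕⁻ f) = 𝓕 f ∘ Neg.neg := funext fun x => Real.fourierInv_eq_fourier_neg f x
  rw [this]
  exact eLpNorm_comp_measurePreserving (continuous_fourier h1).aestronglyMeasurable
    (Measure.measurePreserving_neg volume)

/-- On `L¹ ∩ L²` the inverse `L²` Fourier transform is the inverse Fourier integral. -/
theorem coeFn_fourierInv_toLp {f : V → ℂ} (h1 : Integrable f) (h2 : MemLp f 2 volume) :
    (𝓕⁻ (h2.toLp f) : Lp ℂ 2 (volume : Measure V)) =ᵐ[volume] 𝓕⁻ f := by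
  have h1' : Integrable (fun x => f (-x)) := h1.comp_neg
  have hcont : Continuous (𝓕⁻ f) := by
    rw [Real.fourierInv_eq_fourier_comp_neg]
    exact continuous_fourier h1'
  refine ae_eq_of_integral_contDiff_smul_eq
    ((Lp.memLp _).locallyIntegrable (by norm_num)) hcont.locallyIntegrable fun g hg hgs => ?_
  let G : SchwartzMap V ℂ := HasCompactSupport.toSchwartzMap (f := fun x => (g x : ℂ))
    (hgs.comp_left (g := fun r : ℝ => (r : ℂ)) (by simp)) (Complex.ofRealCLM.contDiff.comp hg)
  have hG : ∀ x, G x = (g x : ℂ) := fun x => rfl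
  have h := congrArg (fun T => T G) (Lp.fourierInv_toTemperedDistribution_eq (h2.toLp f))
  simp only [TemperedDistribution.fourierInv_apply, Lp.toTemperedDistribution_apply] at h
  have hflip := VectorFourier.integral_fourierIntegral_smul_eq_flip (μ := (volume : Measure V))
    (ν := (volume : Measure V)) (L := innerₗ V) (f := fun x => G x) (g := fun x => f (-x))
    Real.continuous_fourierChar (by exact continuous_inner) G.integrable h1'
  calc ∫ x, g x • (𝓕⁻ (h2.toLp f) : Lp ℂ 2 (volume : Measure V)) x
      = ∫ x, G x • (𝓕⁻ (h2.toLp f) : Lp ℂ 2 (volume : Measure V)) x := by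
        simp only [hG, smul_eq_mul, Complex.real_smul]
    _ = ∫ x, (𝓕⁻ G : SchwartzMap V ℂ) x • (h2.toLp f) x := h.symm
    _ = ∫ x, (𝓕⁻ G : SchwartzMap V ℂ) x • f x := by
        refine integral_congr_ae ?_
        filter_upwards [h2.coeFn_toLp] with x hx
        rw [hx]
    _ = ∫ x, (𝓕 G : SchwartzMap V ℂ) x • f (-x) := by
        rw [← integral_neg_eq_self]
        refine integral_congr_ae (Filter.Eventually.of_forall fun x => ?_)
        simp only [SchwartzMap.fourierInv_coe, SchwartzMap.fourier_coe,
          Real.fourierInv_eq_fourier_neg, neg_neg]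
    _ = ∫ x, G x • 𝓕⁻ f x := by
        rw [flip_innerₗ] at hflip
        rw [Real.fourierInv_eq_fourier_comp_neg]
        exact hflip
    _ = _ := by simp only [hG, smul_eq_mul, Complex.real_smul]

/-- An `L²` function with integrable Fourier transform is bounded. -/
theorem memLp_top_of_integrable_fourier {u : Lp ℂ 2 (volume : Measure V)}
    (h : Integrable (𝓕 u : Lp ℂ 2 (volume : Measure V))) : MemLp u ∞ volume := by
  have h1 := coeFn_fourierInv_toLp h (Lp.memLp (𝓕 u : Lp ℂ 2 (volume : Measure V)))
  rw [Lp.toLp_coeFn, FourierTransform.fourierInv_fourier_eq] at h1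
  refine memLp_top_of_bound
    (C := ∫ x, ‖(𝓕 u : Lp ℂ 2 (volume : Measure V)) x‖) (Lp.memLp u).1 ?_
  filter_upwards [h1] with x hx
  rw [hx]
  exact VectorFourier.norm_fourierIntegral_le_integral_norm _ _ _ _ _

end Fourier

/-! ### Square integrability in time of oscillatory integrals -/

section TimePlancherel

variable {α : Type*} [MeasurableSpace α] {ν : Measure α}

/-- The oscillatory integral `t ↦ ∫ e^{-itφ} a dν`. -/
def oscIntegral (ν : Measure α) (φ : α → ℝ) (a : α → ℂ) (t : ℝ) : ℂ :=
  ∫ η, Complex.exp (-Complex.I * ((t * φ η : ℝ) : ℂ)) * a η ∂ν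

theorem norm_exp_neg_I_mul (r : ℝ) : ‖Complex.exp (-Complex.I * (r : ℂ))‖ = 1 := by
  simp [Complex.norm_exp]

theorem continuous_oscIntegral {φ : α → ℝ} (hφ : Measurable φ) {a : α → ℂ}
    (ha : Integrable a ν) : Continuous (oscIntegral ν φ a) := by
  refine continuous_of_dominated (bound := fun η => ‖a η‖) (fun t => ?_) (fun t => ?_) ha.norm ?_
  · exact (Measurable.aestronglyMeasurable (by fun_prop)).mul ha.1
  · exact Filter.Eventually.of_forall fun η => by rw [norm_mul, norm_exp_neg_I_mul, one_mul]
  · exact Filter.Eventually.of_forall fun η => by fun_prop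

/-- Layer-cake comparison: the superlevel sets of the Gaussian are symmetric intervals about `s`,
and the hypothesis says that the push-forward of `ν` by `φ` charges an interval at most `M` times
its length. -/
theorem lintegral_gaussian_comp_le {φ : α → ℝ} (hφ : Measurable φ) {M : ℝ} (hM : 0 ≤ M)
    (hlev : ∀ x y, x < y → ν {η | x < φ η ∧ φ η < y} ≤ ENNReal.ofReal (M * (y - x)))
    {b : ℝ} (hb : 0 < b) (s : ℝ) :
    ∫⁻ η, ENNReal.ofReal (Real.exp (-b * (s - φ η) ^ 2)) ∂ν ≤
      ENNReal.ofReal M * ENNReal.ofReal (Real.sqrt (Real.pi / b)) := by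
  have hlevel : ∀ h : ℝ, 0 < h → ∀ τ : ℝ, h < Real.exp (-b * τ ^ 2) ↔
      |τ| < Real.sqrt (-Real.log h / b) := by
    intro h hh τ
    rw [Real.lt_sqrt (abs_nonneg _), sq_abs, lt_div_iff₀ hb, ← Real.log_lt_iff_lt_exp hh]
    constructor <;> intro h <;> linarith
  have hgauss : ∫⁻ τ : ℝ, ENNReal.ofReal (Real.exp (-b * τ ^ 2)) =
      ENNReal.ofReal (Real.sqrt (Real.pi / b)) := by
    rw [← integral_gaussian, ofReal_integral_eq_lintegral_ofReal (integrable_exp_neg_mul_sq hb)]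
    exact Filter.Eventually.of_forall fun _ => (Real.exp_pos _).le
  rw [← hgauss, lintegral_eq_lintegral_meas_lt _
    (Filter.Eventually.of_forall fun _ => (Real.exp_pos _).le)
    (Measurable.aemeasurable (by fun_prop)), lintegral_eq_lintegral_meas_lt _
    (Filter.Eventually.of_forall fun _ => (Real.exp_pos _).le)
    (Measurable.aemeasurable (by fun_prop)), ← lintegral_const_mul' _ _ ENNReal.ofReal_ne_top]
  refine setLIntegral_mono' measurableSet_Ioi fun h hh => ?_
  simp only [hlevel h hh]
  set r := Real.sqrt (-Real.log h / b)
  have e1 : {η | |s - φ η| < r} = {η | s - r < φ η ∧ φ η < s + r} := by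
    ext η
    simp only [Set.mem_ofPred_eq, abs_lt]
    constructor <;> rintro ⟨h1, h2⟩ <;> constructor <;> linarith
  have e2 : {τ : ℝ | |τ| < r} = Set.Ioo (-r) r := by
    ext τ
    simp [abs_lt]
  rw [e1, e2, Real.volume_Ioo, ← ENNReal.ofReal_mul hM]
  rcases lt_or_ge 0 r with hr | hr
  · refine (hlev _ _ (by linarith)).trans (le_of_eq ?_)
    congr 1
    ring
  · have : {η | s - r < φ η ∧ φ η < s + r} = ∅ := by
      ext η
      simp only [Set.mem_ofPred_eq, Set.mem_empty_iff_false, iff_false]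
      rintro ⟨h1, h2⟩
      linarith
    simp [this]

theorem integral_gaussian_mul_exp {ε : ℝ} (hε : 0 < ε) (s : ℝ) :
    ∫ t : ℝ, (Real.exp (-ε * t ^ 2) : ℂ) * Complex.exp (-Complex.I * ((t * s : ℝ) : ℂ)) =
      (Real.sqrt (Real.pi / ε) * Real.exp (-(4 * ε)⁻¹ * s ^ 2) : ℝ) := by
  have h := fourierIntegral_gaussian (b := (ε : ℂ)) (by simpa using hε) (-(s : ℂ))
  rw [show (fun t : ℝ => (Real.exp (-ε * t ^ 2) : ℂ) *
      Complex.exp (-Complex.I * ((t * s : ℝ) : ℂ))) = fun t : ℝ =>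
      Complex.exp (Complex.I * -(s : ℂ) * t) * Complex.exp (-(ε : ℂ) * t ^ 2) by
    ext t
    push_cast
    rw [mul_comm]
    congr 2
    ring, h]
  push_cast
  congr 1
  · rw [Real.sqrt_eq_rpow, Complex.ofReal_cpow (by positivity)]
    push_cast
    rfl
  · congr 1
    field_simp

/-- The weight `e^{-εt²}` makes Fubini legitimate. Expanding the square and integrating in `t`
leaves a positive kernel `k(φ η - φ η')`, to which Schur's test applies. -/
theorem lintegral_gaussian_mul_oscIntegral_sq_le [SFinite ν] {φ : α → ℝ} (hφ : Measurable φ) {M : ℝ}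
    (hM : 0 ≤ M)
    (hlev : ∀ x y, x < y → ν {η | x < φ η ∧ φ η < y} ≤ ENNReal.ofReal (M * (y - x)))
    {a : α → ℂ} (ha : Integrable a ν) {ε : ℝ} (hε : 0 < ε) :
    ∫⁻ t : ℝ, ENNReal.ofReal (Real.exp (-ε * t ^ 2)) * ‖oscIntegral ν φ a t‖ₑ ^ 2 ≤
      ENNReal.ofReal (2 * Real.pi * M) * ∫⁻ η, ‖a η‖ₑ ^ 2 ∂ν := by
  set H := oscIntegral ν φ a with hH
  have hHb : ∀ t, ‖H t‖ ≤ ∫ η, ‖a η‖ ∂ν := fun t => by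
    refine (norm_integral_le_integral_norm _).trans (le_of_eq ?_)
    refine integral_congr_ae (Filter.Eventually.of_forall fun η => ?_)
    simp only [norm_mul, norm_exp_neg_I_mul, one_mul]
  have hHc : Continuous H := continuous_oscIntegral hφ ha
  set k : ℝ → ℝ := fun s => Real.sqrt (Real.pi / ε) * Real.exp (-(4 * ε)⁻¹ * s ^ 2) with hk
  have hk0 : ∀ s, 0 ≤ k s := fun s => by positivity
  have hkm : Measurable k := by fun_prop
  have hgi : Integrable fun t : ℝ => Real.exp (-ε * t ^ 2) := integrable_exp_neg_mul_sq hε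
  have hA : Integrable (fun p : α × α => a p.1 * star (a p.2)) (ν.prod ν) :=
    ha.mul_prod (g := fun η => star (a η)) (by
      simpa using (Complex.conjCLE : ℂ →L[ℝ] ℂ).integrable_comp ha)
  have key : ((∫ t : ℝ, Real.exp (-ε * t ^ 2) * ‖H t‖ ^ 2 : ℝ) : ℂ) =
      ∫ p : α × α, (k (φ p.1 - φ p.2) : ℂ) * (a p.1 * star (a p.2)) ∂(ν.prod ν) := by
    have e1 : ∀ t : ℝ, ((Real.exp (-ε * t ^ 2) * ‖H t‖ ^ 2 : ℝ) : ℂ) =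
        ∫ p : α × α, (Real.exp (-ε * t ^ 2) : ℂ) *
          Complex.exp (-Complex.I * ((t * (φ p.1 - φ p.2) : ℝ) : ℂ)) *
          (a p.1 * star (a p.2)) ∂(ν.prod ν) := by
      intro t
      have : ((‖H t‖ ^ 2 : ℝ) : ℂ) = H t * star (H t) := by
        rw [Complex.star_def, Complex.mul_conj, Complex.normSq_eq_norm_sq]
      rw [Complex.ofReal_mul, this, hH]
      have hs : star (oscIntegral ν φ a t) =
          ∫ η, star (Complex.exp (-Complex.I * ((t * φ η : ℝ) : ℂ)) * a η) ∂ν := by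
        rw [oscIntegral, Complex.star_def, ← integral_conj]
      rw [hs, oscIntegral, ← integral_prod_mul, ← integral_const_mul]
      refine integral_congr_ae (Filter.Eventually.of_forall fun p => ?_)
      simp only [star_mul', Complex.star_def, ← Complex.exp_conj, map_mul, map_neg, Complex.conj_I,
        Complex.conj_ofReal]
      rw [show -Complex.I * ((t * (φ p.1 - φ p.2) : ℝ) : ℂ) =
        -Complex.I * ((t * φ p.1 : ℝ) : ℂ) + -(-Complex.I) * ((t * φ p.2 : ℝ) : ℂ) by
          push_cast; ring, Complex.exp_add]
      ring
    rw [← integral_complex_ofReal]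
    simp_rw [e1]
    rw [integral_integral_swap]
    · refine integral_congr_ae (Filter.Eventually.of_forall fun p => ?_)
      simp only
      rw [integral_mul_const, integral_gaussian_mul_exp hε]
    · have hI := (Complex.ofRealCLM.integrable_comp hgi).mul_prod hA
      refine Integrable.mono hI ?_ (Filter.Eventually.of_forall fun q => ?_)
      · have hm : Measurable fun q : ℝ × (α × α) => (Real.exp (-ε * q.1 ^ 2) : ℂ) *
          Complex.exp (-Complex.I * ((q.1 * (φ q.2.1 - φ q.2.2) : ℝ) : ℂ)) := by fun_prop
        exact hm.aestronglyMeasurable.mul hA.1.comp_snd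
      · simp only [Function.uncurry, norm_mul, norm_exp_neg_I_mul, mul_one,
          Complex.ofRealCLM_apply]
        exact le_rfl
  have hint : Integrable fun t : ℝ => Real.exp (-ε * t ^ 2) * ‖H t‖ ^ 2 := by
    refine hgi.mul_bdd (c := (∫ η, ‖a η‖ ∂ν) ^ 2) ?_ (Filter.Eventually.of_forall fun t => ?_)
    · exact (hHc.norm.pow 2).aestronglyMeasurable
    · rw [norm_pow, norm_norm]
      exact pow_le_pow_left₀ (norm_nonneg _) (hHb t) 2
  have hL : ∫⁻ t : ℝ, ENNReal.ofReal (Real.exp (-ε * t ^ 2)) * ‖H t‖ₑ ^ 2 =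
      ‖((∫ t : ℝ, Real.exp (-ε * t ^ 2) * ‖H t‖ ^ 2 : ℝ) : ℂ)‖ₑ := by
    rw [← ofReal_norm, Complex.norm_real, Real.norm_of_nonneg
      (integral_nonneg fun t => by positivity), ofReal_integral_eq_lintegral_ofReal hint
      (Filter.Eventually.of_forall fun t => by positivity)]
    refine lintegral_congr fun t => ?_
    rw [ENNReal.ofReal_mul (Real.exp_pos _).le, ENNReal.ofReal_pow (norm_nonneg _), ofReal_norm]
  have ham : AEMeasurable (fun η => ‖a η‖ₑ ^ 2) ν := ha.1.enorm.pow_const 2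
  have hKm : Measurable fun p : α × α => ENNReal.ofReal (k (φ p.1 - φ p.2)) := by fun_prop
  have hKa : AEMeasurable (fun p : α × α => ENNReal.ofReal (k (φ p.1 - φ p.2)) * ‖a p.1‖ₑ ^ 2)
      (ν.prod ν) := hKm.aemeasurable.mul ham.comp_fst
  have hsup : ∀ s, ∫⁻ η, ENNReal.ofReal (k (s - φ η)) ∂ν ≤ ENNReal.ofReal (2 * Real.pi * M) := by
    intro s
    simp only [hk]
    simp_rw [ENNReal.ofReal_mul (Real.sqrt_nonneg (Real.pi / ε))]
    rw [lintegral_const_mul' _ _ ENNReal.ofReal_ne_top]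
    refine (mul_le_mul_right (lintegral_gaussian_comp_le hφ hM hlev (by positivity) s) _).trans
      (le_of_eq ?_)
    rw [← ENNReal.ofReal_mul hM, ← ENNReal.ofReal_mul (Real.sqrt_nonneg _)]
    congr 1
    -- `√(π/ε) · √(4πε) = 2π`: `ε` cancels, so the bound survives the limit `ε → 0`.
    rw [mul_left_comm, ← Real.sqrt_mul (by positivity),
      show Real.pi / ε * (Real.pi / (4 * ε)⁻¹) = (2 * Real.pi) ^ 2 by field_simp; ring,
      Real.sqrt_sq (by positivity), mul_comm]
  have hhalf : ∫⁻ p : α × α, ENNReal.ofReal (k (φ p.1 - φ p.2)) * ‖a p.1‖ₑ ^ 2 ∂(ν.prod ν) ≤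
      ENNReal.ofReal (2 * Real.pi * M) * ∫⁻ η, ‖a η‖ₑ ^ 2 ∂ν := by
    rw [lintegral_prod _ hKa, ← lintegral_const_mul'' _ ham]
    refine lintegral_mono fun η => ?_
    simp only
    rw [lintegral_mul_const _ (by fun_prop)]
    exact mul_le_mul_left (hsup _) _
  have hhalf' : ∫⁻ p : α × α, ENNReal.ofReal (k (φ p.1 - φ p.2)) * ‖a p.2‖ₑ ^ 2 ∂(ν.prod ν) ≤
      ENNReal.ofReal (2 * Real.pi * M) * ∫⁻ η, ‖a η‖ₑ ^ 2 ∂ν := by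
    refine le_trans (le_of_eq ?_) hhalf
    rw [← lintegral_prod_swap]
    refine lintegral_congr fun p => ?_
    simp only [Prod.fst_swap, Prod.snd_swap, hk]
    rw [show (φ p.2 - φ p.1) ^ 2 = (φ p.1 - φ p.2) ^ 2 by ring]
  rw [hL, key]
  refine (enorm_integral_le_lintegral_enorm _).trans ?_
  -- Schur's test through `2|a||a'| ≤ |a|² + |a'|²`; the factor 2 is kept on both sides and
  -- cancelled at the end.
  have h2 : 2 * ∫⁻ p : α × α, ‖(k (φ p.1 - φ p.2) : ℂ) * (a p.1 * star (a p.2))‖ₑ ∂(ν.prod ν) ≤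
      2 * (ENNReal.ofReal (2 * Real.pi * M) * ∫⁻ η, ‖a η‖ₑ ^ 2 ∂ν) := by
    rw [← lintegral_const_mul' _ _ (by norm_num), two_mul (ENNReal.ofReal _ * _)]
    refine le_trans ?_ (add_le_add hhalf hhalf')
    rw [← lintegral_add_left' hKa]
    refine lintegral_mono fun p => ?_
    simp only
    rw [enorm_mul, enorm_mul, show ‖star (a p.2)‖ₑ = ‖a p.2‖ₑ by rw [← ofReal_norm, norm_star, ofReal_norm], ← ofReal_norm (k _ : ℂ), Complex.norm_real,
      Real.norm_of_nonneg (hk0 _), ← mul_add, mul_left_comm, ← mul_assoc 2]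
    refine mul_le_mul_right ?_ _
    simp only [enorm_eq_nnnorm]
    exact_mod_cast two_mul_le_add_sq ‖a p.1‖₊ ‖a p.2‖₊
  exact (ENNReal.mul_le_mul_iff_right (by norm_num) (by norm_num)).1 h2

/-- If the level sets of the phase `φ` satisfy `ν {x < φ < y} ≤ M (y - x)`, then the oscillatory
integral with amplitude `a` is square integrable in time, with constant `2πM`. -/
theorem lintegral_oscIntegral_sq_le [SFinite ν] {φ : α → ℝ} (hφ : Measurable φ) {M : ℝ}
    (hM : 0 ≤ M)
    (hlev : ∀ x y, x < y → ν {η | x < φ η ∧ φ η < y} ≤ ENNReal.ofReal (M * (y - x)))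
    {a : α → ℂ} (ha : Integrable a ν) :
    ∫⁻ t : ℝ, ‖oscIntegral ν φ a t‖ₑ ^ 2 ≤
      ENNReal.ofReal (2 * Real.pi * M) * ∫⁻ η, ‖a η‖ₑ ^ 2 ∂ν := by
  have hHc := continuous_oscIntegral hφ ha
  -- Fatou's lemma along `ε → 0` removes the Gaussian weight.
  let ε : ℕ → ℝ := fun n => 1 / ((n : ℝ) + 1)
  have hε : ∀ n, 0 < ε n := fun n => by positivity
  have hlim : ∀ t : ℝ, Filter.Tendsto (fun n => ENNReal.ofReal (Real.exp (-ε n * t ^ 2)) *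
      ‖oscIntegral ν φ a t‖ₑ ^ 2) Filter.atTop (nhds (‖oscIntegral ν φ a t‖ₑ ^ 2)) := by
    intro t
    have h0 : Filter.Tendsto (fun n => Real.exp (-ε n * t ^ 2)) Filter.atTop (nhds 1) := by
      have h1 := ((tendsto_one_div_add_atTop_nhds_zero_nat (𝕜 := ℝ)).neg.mul_const (t ^ 2)).rexp
      simpa [ε] using h1
    have h2 := ENNReal.Tendsto.mul_const (b := ‖oscIntegral ν φ a t‖ₑ ^ 2)
      (ENNReal.tendsto_ofReal h0) (Or.inr (by finiteness))
    simpa using h2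
  calc ∫⁻ t : ℝ, ‖oscIntegral ν φ a t‖ₑ ^ 2
      = ∫⁻ t : ℝ, Filter.liminf (fun n => ENNReal.ofReal (Real.exp (-ε n * t ^ 2)) *
          ‖oscIntegral ν φ a t‖ₑ ^ 2) Filter.atTop :=
        lintegral_congr fun t => (hlim t).liminf_eq.symm
    _ ≤ Filter.liminf (fun n => ∫⁻ t : ℝ, ENNReal.ofReal (Real.exp (-ε n * t ^ 2)) *
          ‖oscIntegral ν φ a t‖ₑ ^ 2) Filter.atTop := by
        refine lintegral_liminf_le fun n => ?_
        exact Measurable.mul (by fun_prop) (hHc.measurable.enorm.pow_const 2)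
    _ ≤ _ := by
        refine Filter.liminf_le_of_le (by isBoundedDefault) fun b hb => ?_
        obtain ⟨n, hn⟩ := hb.exists
        exact hn.trans (lintegral_gaussian_mul_oscIntegral_sq_le hφ hM hlev ha (hε n))

end TimePlancherel

/-! ### From level sets to a bilinear estimate -/

section Bilinear

variable {V : Type*} [NormedAddCommGroup V] [InnerProductSpace ℝ V] [FiniteDimensional ℝ V]
  [MeasurableSpace V] [BorelSpace V]

theorem memLp_comp_sub_left {G : V → ℂ} (hG : MemLp G 2 volume) (ξ : V) :
    MemLp (fun η => G (ξ - η)) 2 volume :=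
  hG.comp_measurePreserving (measurePreserving_sub_left_volume ξ)

theorem integrable_mul_sub_left {F G : V → ℂ} (hF : MemLp F 2 volume) (hG : MemLp G 2 volume)
    (ξ : V) : Integrable fun η => F η * G (ξ - η) :=
  hF.integrable_mul (memLp_comp_sub_left hG ξ)

/-- Bilinear `L²` estimate from a bound on the level sets of the phase. -/
theorem lintegral_bilinear_oscIntegral_le {F G : V → ℂ} (hF : MemLp F 2 volume)
    (hG : MemLp G 2 volume) {Φ : V → V → ℝ} (hΦ : ∀ ξ, Measurable (Φ ξ)) {A X : Set V}
    (hA : MeasurableSet A) (hX : MeasurableSet X) (hFA : ∀ᵐ η, η ∉ A → F η = 0)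
    {M : ℝ} (hM : 0 ≤ M)
    (hlev : ∀ ξ ∈ X, ∀ x y, x < y →
      volume {η | η ∈ A ∧ x < Φ ξ η ∧ Φ ξ η < y} ≤ ENNReal.ofReal (M * (y - x))) :
    ∫⁻ ξ in X, ∫⁻ t : ℝ, ‖oscIntegral volume (Φ ξ) (fun η => F η * G (ξ - η)) t‖ₑ ^ 2 ≤
      ENNReal.ofReal (2 * Real.pi * M) *
        ((∫⁻ η, ‖F η‖ₑ ^ 2) * ∫⁻ η, ‖G η‖ₑ ^ 2) := by
  have h1 : ∀ ξ ∈ X,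
      ∫⁻ t : ℝ, ‖oscIntegral volume (Φ ξ) (fun η => F η * G (ξ - η)) t‖ₑ ^ 2 ≤
        ENNReal.ofReal (2 * Real.pi * M) * ∫⁻ η, ‖F η‖ₑ ^ 2 * ‖G (ξ - η)‖ₑ ^ 2 := by
    intro ξ hξ
    -- The level sets are controlled only inside `A`; since `F` vanishes off `A`, the time estimate
    -- can be applied to Lebesgue measure restricted to `A`.
    have e : ∀ t, oscIntegral volume (Φ ξ) (fun η => F η * G (ξ - η)) t =
        oscIntegral (volume.restrict A) (Φ ξ) (fun η => F η * G (ξ - η)) t := by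
      intro t
      refine (setIntegral_eq_integral_of_ae_compl_eq_zero ?_).symm
      filter_upwards [hFA] with η hη hηA
      rw [hη hηA, zero_mul, mul_zero]
    simp_rw [e]
    refine (lintegral_oscIntegral_sq_le (hΦ ξ) hM (fun x y hxy => ?_)
      (integrable_mul_sub_left hF hG ξ).restrict).trans ?_
    · rw [Measure.restrict_apply' hA]
      refine le_trans (measure_mono ?_) (hlev ξ hξ x y hxy)
      rintro η ⟨h, hA⟩
      exact ⟨hA, h⟩
    · refine mul_le_mul_right ((lintegral_mono' Measure.restrict_le_self le_rfl).trans
        (le_of_eq ?_)) _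
      simp_rw [enorm_mul, mul_pow]
  refine (setLIntegral_mono' hX h1).trans ?_
  rw [lintegral_const_mul' _ _ ENNReal.ofReal_ne_top]
  refine mul_le_mul_right ?_ _
  refine (lintegral_mono' Measure.restrict_le_self le_rfl).trans ?_
  have hFm : AEMeasurable (fun η => ‖F η‖ₑ ^ 2) (volume : Measure V) := hF.1.enorm.pow_const 2
  have hGm : AEMeasurable (fun η => ‖G η‖ₑ ^ 2) (volume : Measure V) := hG.1.enorm.pow_const 2
  have hsub : Measure.QuasiMeasurePreserving (fun p : V × V => p.1 - p.2)
      (volume.prod volume) volume := quasiMeasurePreserving_sub_of_right_invariant volume volume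
  -- Integrating in `ξ` first, translation invariance factors the double integral.
  rw [lintegral_lintegral_swap]
  · rw [← lintegral_mul_const'' _ hFm]
    refine lintegral_mono fun η => ?_
    simp only
    rw [lintegral_const_mul' _ _ (by finiteness),
      lintegral_sub_right_eq_self (fun ξ => ‖G ξ‖ₑ ^ 2) η]
  · exact hFm.comp_snd.mul (hGm.comp_quasiMeasurePreserving hsub)

end Bilinear

/-! ### Planar level sets and convexity of square roots -/

section LevelSets

theorem le_of_sq_le_sq_of_nonneg {x y : ℝ} (hy : 0 ≤ y) (h : x ^ 2 ≤ y ^ 2) : x ≤ y :=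
  (le_abs_self x).trans (abs_le_of_sq_le_sq h hy)

/-- With `r₀ = inf P`, the set lies in `[r₀, √(r₀² + D)]`, over which `r dr` integrates to exactly
`D/2`. Measurability of `P` plays no role. -/
theorem lintegral_radial_le {P : Set ℝ} (hP : P ⊆ Set.Ioi 0) {D : ℝ} (hD : 0 ≤ D)
    (h : ∀ r ∈ P, ∀ r' ∈ P, r < r' → r' ^ 2 - r ^ 2 ≤ D) :
    ∫⁻ r in P, ENNReal.ofReal r ≤ ENNReal.ofReal (D / 2) := by
  rcases P.eq_empty_or_nonempty with rfl | hne
  · simp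
  have hbd : BddBelow P := ⟨0, fun r hr => (hP hr).le⟩
  set r₀ := sInf P with hr₀
  have h0 : 0 ≤ r₀ := le_csInf hne fun r hr => (hP hr).le
  have hsub : P ⊆ Set.Icc r₀ (Real.sqrt (r₀ ^ 2 + D)) := by
    intro r' hr'
    refine ⟨csInf_le hbd hr', Real.le_sqrt_of_sq_le ?_⟩
    have h1 : Real.sqrt (r' ^ 2 - D) ≤ r₀ := by
      refine le_csInf hne fun r hr => ?_
      rw [Real.sqrt_le_left (hP hr).le]
      rcases lt_or_ge r r' with hlt | hge
      · linarith [h r hr r' hr' hlt]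
      · nlinarith [Set.mem_Ioi.1 (hP hr')]
    have h2 := (Real.sqrt_le_left h0).1 h1
    linarith
  have hR : r₀ ≤ Real.sqrt (r₀ ^ 2 + D) := Real.le_sqrt_of_sq_le (by linarith)
  refine (lintegral_mono_set hsub).trans (le_of_eq ?_)
  rw [← ofReal_integral_eq_lintegral_ofReal]
  · rw [integral_Icc_eq_integral_Ioc, ← intervalIntegral.integral_of_le hR, integral_id,
      Real.sq_sqrt (by positivity)]
    congr 1
    ring
  · exact continuous_id.continuousOn.integrableOn_Icc
  · filter_upwards [ae_restrict_mem measurableSet_Icc] with r hr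
    exact h0.trans hr.1

/-- Level sets of a strongly convex function in the plane: the area of `{x < f < y}` is at most
`2π (y - x) / κ`, where `κ` is the modulus of convexity. -/
theorem volume_level_strongConvex_le {Q : Set (ℝ × ℝ)} (hQ : IsCompact Q) (hQc : Convex ℝ Q)
    {f : ℝ × ℝ → ℝ} (hf : Continuous f) {κ : ℝ} (hκ : 0 < κ)
    (hsc : ∀ p ∈ Q, ∀ q ∈ Q, ∀ θ : ℝ, 0 < θ → θ < 1 →
      f ((1 - θ) • p + θ • q) ≤ (1 - θ) * f p + θ * f q -
        θ * (1 - θ) * (κ / 2) * ((q.1 - p.1) ^ 2 + (q.2 - p.2) ^ 2))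
    {x y : ℝ} (hxy : x < y) :
    volume {q | q ∈ Q ∧ x < f q ∧ f q < y} ≤ ENNReal.ofReal (2 * Real.pi / κ * (y - x)) := by
  rcases Q.eq_empty_or_nonempty with rfl | hne
  · simp
  -- Polar coordinates will be centred at a minimum point on `Q`. It may lie on the boundary, since
  -- no derivative is used.
  obtain ⟨p, hp, hmin⟩ := hQ.exists_isMinOn hne hf.continuousOn
  have hmin' : ∀ q ∈ Q, f p ≤ f q := fun q hq => hmin hq
  -- Quadratic growth from the minimum: compare `f p` with the value at `(1-θ)p + θq`, divide by `θ`
  -- and let `θ → 0`.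
  have hquad : ∀ q ∈ Q, κ / 2 * ((q.1 - p.1) ^ 2 + (q.2 - p.2) ^ 2) ≤ f q - f p := by
    intro q hq
    set N := κ / 2 * ((q.1 - p.1) ^ 2 + (q.2 - p.2) ^ 2) with hN
    have h1 : ∀ θ : ℝ, 0 < θ → θ < 1 → (1 - θ) * N ≤ f q - f p := by
      intro θ h0 h1
      have h2 := hsc p hp q hq θ h0 h1
      have h3 := hmin' _ (hQc hp hq (by linarith : 0 ≤ 1 - θ) h0.le (by ring))
      have h4 : θ * ((1 - θ) * N) ≤ θ * (f q - f p) := by rw [hN]; linarith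
      exact le_of_mul_le_mul_left h4 h0
    have hlim : Filter.Tendsto (fun θ : ℝ => (1 - θ) * N) (nhdsWithin 0 (Set.Ioi 0))
        (nhds ((1 - 0) * N)) :=
      (Continuous.tendsto (by fun_prop) 0).mono_left nhdsWithin_le_nhds
    rw [sub_zero, one_mul] at hlim
    refine le_of_tendsto hlim ?_
    filter_upwards [Ioo_mem_nhdsGT (show (0 : ℝ) < 1 by norm_num)] with θ hθ
    exact h1 θ hθ.1 hθ.2
  set S : Set (ℝ × ℝ) := {q | q ∈ Q ∧ x < f q ∧ f q < y} with hS
  have hSm : MeasurableSet S := hQ.measurableSet.inter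
    ((measurableSet_lt measurable_const hf.measurable).inter
      (measurableSet_lt hf.measurable measurable_const))
  set S' : Set (ℝ × ℝ) := (fun v => p + v) ⁻¹' S with hS'
  have hSm' : MeasurableSet S' := hSm.preimage (measurable_const_add p)
  have hvol : volume S = volume S' := (measure_preimage_add volume p S).symm
  have hray : ∀ θ : ℝ, ∫⁻ r in Set.Ioi (0 : ℝ), ENNReal.ofReal r *
      S'.indicator 1 (polarCoord.symm (r, θ)) ≤ ENNReal.ofReal ((y - x) / κ) := by
    intro θ
    set P : Set ℝ := {r | 0 < r ∧ polarCoord.symm (r, θ) ∈ S'} with hP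
    have hPm : MeasurableSet {r : ℝ | polarCoord.symm (r, θ) ∈ S'} := by
      refine hSm'.preimage ?_
      simp only [polarCoord_symm_apply]
      fun_prop
    have hdiff : ∀ r ∈ P, ∀ r' ∈ P, r < r' → r' ^ 2 - r ^ 2 ≤ 2 * ((y - x) / κ) := by
      rintro r ⟨hr, hrQ, hr1, hr2⟩ r' ⟨hr', hrQ', hr1', hr2'⟩ hlt
      rw [polarCoord_symm_apply] at hrQ hr1 hr2 hrQ' hr1' hr2'
      set q : ℝ × ℝ := p + (r * Real.cos θ, r * Real.sin θ) with hq
      set q' : ℝ × ℝ := p + (r' * Real.cos θ, r' * Real.sin θ) with hq'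
      have hnorm : (q'.1 - p.1) ^ 2 + (q'.2 - p.2) ^ 2 = r' ^ 2 := by
        simp only [hq', Prod.fst_add, Prod.snd_add, add_sub_cancel_left]
        linear_combination r' ^ 2 * Real.sin_sq_add_cos_sq θ
      have hθ : (1 - r / r') • p + (r / r') • q' = q := by
        ext
        · simp [hq, hq']
          field_simp
          ring
        · simp [hq, hq']
          field_simp
          ring
      -- On a ray, `q` divides `[p, q']` with `θ = r/r'`. Strong convexity gives `(1-θ)(f q' - f p)
      -- + θ(1-θ)(κ/2)r'² ≤ f q' - f q`; inserting quadratic growth leaves `(1-θ²)(κ/2)r'² =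
      -- (κ/2)(r'² - r²)`.
      have h1 := hsc p hp q' hrQ' (r / r') (by positivity) ((div_lt_one hr').2 hlt)
      have h2 := hquad q' hrQ'
      rw [hθ, hnorm] at h1
      rw [hnorm] at h2
      have h3 : (1 - r / r') * (κ / 2 * r' ^ 2) ≤ (1 - r / r') * (f q' - f p) :=
        mul_le_mul_of_nonneg_left h2 (by linarith [(div_lt_one hr').2 hlt])
      have h4 : κ / 2 * (r' ^ 2 - r ^ 2) ≤ f q' - f q := by
        have e : κ / 2 * (r' ^ 2 - r ^ 2) = (1 - r / r') * (κ / 2 * r' ^ 2) +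
            r / r' * (1 - r / r') * (κ / 2) * r' ^ 2 := by
          field_simp
          ring
        rw [e]
        linarith
      have h5 : κ * (r' ^ 2 - r ^ 2) ≤ 2 * (y - x) := by linarith
      rw [← mul_div_assoc, le_div_iff₀ hκ]
      linarith
    have h := lintegral_radial_le (P := P) (fun r hr => hr.1)
      (by have := sub_pos.2 hxy; positivity) hdiff
    rw [mul_div_cancel_left₀ _ (two_ne_zero)] at h
    refine le_trans (le_of_eq ?_) h
    have hPi : P = {r : ℝ | polarCoord.symm (r, θ) ∈ S'} ∩ Set.Ioi 0 := by
      ext r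
      simp [hP, and_comm]
    rw [hPi, ← Measure.restrict_restrict hPm, ← lintegral_indicator hPm]
    refine lintegral_congr fun r => ?_
    by_cases hr : polarCoord.symm (r, θ) ∈ S'
    · rw [Set.indicator_of_mem hr, Set.indicator_of_mem (by exact hr)]
      simp
    · rw [Set.indicator_of_notMem hr, Set.indicator_of_notMem (by exact hr)]
      simp
  rw [hvol, ← lintegral_indicator_one hSm', ← lintegral_comp_polarCoord_symm,
    polarCoord_target, Measure.volume_eq_prod, ← Measure.prod_restrict]
  refine (lintegral_prod_symm' _ ?_).trans_le ?_
  · refine Measurable.mul (by fun_prop) ((measurable_one.indicator hSm').comp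
      continuous_polarCoord_symm.measurable)
  · refine (lintegral_mono fun θ => hray θ).trans ?_
    rw [lintegral_const, Measure.restrict_apply_univ, Real.volume_Ioo,
      ← ENNReal.ofReal_mul (by have := sub_pos.2 hxy; positivity)]
    refine le_of_eq ?_
    congr 1
    ring

/-- Quadratic lower bound for `(u, v) ↦ √(a² + u² + v²)` on a region where it is at most `L`. -/
theorem sqrt_gradient_le {a L : ℝ} (ha : 0 < a) (p q : ℝ × ℝ)
    (hp : Real.sqrt (a ^ 2 + (p.1 ^ 2 + p.2 ^ 2)) ≤ L)
    (hq : Real.sqrt (a ^ 2 + (q.1 ^ 2 + q.2 ^ 2)) ≤ L) :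
    Real.sqrt (a ^ 2 + (p.1 ^ 2 + p.2 ^ 2)) +
      (p.1 * (q.1 - p.1) + p.2 * (q.2 - p.2)) / Real.sqrt (a ^ 2 + (p.1 ^ 2 + p.2 ^ 2)) +
      a ^ 2 / L ^ 3 / 2 * ((q.1 - p.1) ^ 2 + (q.2 - p.2) ^ 2) ≤
      Real.sqrt (a ^ 2 + (q.1 ^ 2 + q.2 ^ 2)) := by
  obtain ⟨p1, p2⟩ := p
  obtain ⟨q1, q2⟩ := q
  simp only at hp hq ⊢
  have hJ : 0 < Real.sqrt (a ^ 2 + (p1 ^ 2 + p2 ^ 2)) := by positivity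
  have hJ' : 0 < Real.sqrt (a ^ 2 + (q1 ^ 2 + q2 ^ 2)) := by positivity
  have hJ2 := Real.sq_sqrt (show 0 ≤ a ^ 2 + (p1 ^ 2 + p2 ^ 2) by positivity)
  have hJ2' := Real.sq_sqrt (show 0 ≤ a ^ 2 + (q1 ^ 2 + q2 ^ 2) by positivity)
  set J := Real.sqrt (a ^ 2 + (p1 ^ 2 + p2 ^ 2))
  set J' := Real.sqrt (a ^ 2 + (q1 ^ 2 + q2 ^ 2))
  have hL : 0 < L := hJ.trans_le hp
  -- `B` is the inner product of `(a, p)` and `(a, q)`. Lagrange's identity gives `(JJ')² - B² ≥ D`,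
  -- and dividing by `JJ' + B ≤ 2L²` makes Cauchy–Schwarz quantitative.
  set B := a ^ 2 + (p1 * q1 + p2 * q2) with hB
  set D := a ^ 2 * ((q1 - p1) ^ 2 + (q2 - p2) ^ 2) with hD
  have hD0 : 0 ≤ D := by positivity
  have hW : 0 < J * J' := mul_pos hJ hJ'
  have hWL : J * J' ≤ L ^ 2 := by rw [sq]; exact mul_le_mul hp hq hJ'.le hL.le
  have hsq : B ^ 2 + D ≤ (J * J') ^ 2 := by
    rw [mul_pow, hJ2, hJ2', hB, hD]
    nlinarith [sq_nonneg (p1 * q2 - p2 * q1)]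
  have hBW : B ≤ J * J' := le_of_sq_le_sq_of_nonneg hW.le (by linarith)
  have h1 : D ≤ (J * J' - B) * (2 * L ^ 2) := by
    have : (J * J' - B) * (J * J' + B) ≤ (J * J' - B) * (2 * L ^ 2) :=
      mul_le_mul_of_nonneg_left (by linarith) (by linarith)
    nlinarith
  have h2 : B + D / (2 * L ^ 2) ≤ J * J' := by
    have : D / (2 * L ^ 2) ≤ J * J' - B := (div_le_iff₀ (by positivity)).2 h1
    linarith
  have h3 : a ^ 2 / L ^ 3 / 2 * ((q1 - p1) ^ 2 + (q2 - p2) ^ 2) ≤ D / (2 * L ^ 2) / J := by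
    rw [show a ^ 2 / L ^ 3 / 2 * ((q1 - p1) ^ 2 + (q2 - p2) ^ 2) = D / (2 * L ^ 2) / L by
      rw [hD]; field_simp]
    exact div_le_div_of_nonneg_left (by positivity) hJ hp
  have h4 : J + (p1 * (q1 - p1) + p2 * (q2 - p2)) / J = B / J := by
    rw [eq_div_iff hJ.ne', add_mul, div_mul_cancel₀ _ hJ.ne', ← sq, hJ2, hB]
    ring
  have h5 : B / J + D / (2 * L ^ 2) / J ≤ J' := by
    rw [← add_div, div_le_iff₀ hJ]
    linarith
  linarith

/-- Strong convexity of `(u, v) ↦ √(a² + u² + v²)` on a region where it is at most `L`. -/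
theorem sqrt_strongConvex {a L : ℝ} (ha : 0 < a) {p q : ℝ × ℝ} {θ : ℝ} (h0 : 0 < θ) (h1 : θ < 1)
    (hp : Real.sqrt (a ^ 2 + (p.1 ^ 2 + p.2 ^ 2)) ≤ L)
    (hq : Real.sqrt (a ^ 2 + (q.1 ^ 2 + q.2 ^ 2)) ≤ L)
    (hz : Real.sqrt (a ^ 2 + (((1 - θ) • p + θ • q).1 ^ 2 + ((1 - θ) • p + θ • q).2 ^ 2)) ≤ L) :
    Real.sqrt (a ^ 2 + (((1 - θ) • p + θ • q).1 ^ 2 + ((1 - θ) • p + θ • q).2 ^ 2)) ≤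
      (1 - θ) * Real.sqrt (a ^ 2 + (p.1 ^ 2 + p.2 ^ 2)) +
        θ * Real.sqrt (a ^ 2 + (q.1 ^ 2 + q.2 ^ 2)) -
        θ * (1 - θ) * (a ^ 2 / L ^ 3 / 2) * ((q.1 - p.1) ^ 2 + (q.2 - p.2) ^ 2) := by
  -- Tangent-plane bounds at the intermediate point, averaged with weights `1-θ` and `θ`: linear
  -- terms cancel and quadratic ones combine to the factor `θ(1-θ)`.
  have e1 := mul_le_mul_of_nonneg_left (sqrt_gradient_le ha _ p hz hp) (by linarith : 0 ≤ 1 - θ)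
  have e2 := mul_le_mul_of_nonneg_left (sqrt_gradient_le ha _ q hz hq) h0.le
  simp only [Prod.fst_add, Prod.snd_add, Prod.smul_fst, Prod.smul_snd, smul_eq_mul] at *
  set J := Real.sqrt (a ^ 2 + (((1 - θ) * p.1 + θ * q.1) ^ 2 + ((1 - θ) * p.2 + θ * q.2) ^ 2))
  have key : (1 - θ) * (((1 - θ) * p.1 + θ * q.1) * (p.1 - ((1 - θ) * p.1 + θ * q.1)) +
      ((1 - θ) * p.2 + θ * q.2) * (p.2 - ((1 - θ) * p.2 + θ * q.2))) / J +
      θ * (((1 - θ) * p.1 + θ * q.1) * (q.1 - ((1 - θ) * p.1 + θ * q.1)) +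
      ((1 - θ) * p.2 + θ * q.2) * (q.2 - ((1 - θ) * p.2 + θ * q.2))) / J = 0 := by
    rw [← add_div]
    convert zero_div J using 2
    ring
  have e3 := add_le_add e1 e2
  have : (1 - θ) * (a ^ 2 / L ^ 3 / 2 * ((p.1 - ((1 - θ) * p.1 + θ * q.1)) ^ 2 +
      (p.2 - ((1 - θ) * p.2 + θ * q.2)) ^ 2)) + θ * (a ^ 2 / L ^ 3 / 2 *
      ((q.1 - ((1 - θ) * p.1 + θ * q.1)) ^ 2 + (q.2 - ((1 - θ) * p.2 + θ * q.2)) ^ 2)) =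
      θ * (1 - θ) * (a ^ 2 / L ^ 3 / 2) * ((q.1 - p.1) ^ 2 + (q.2 - p.2) ^ 2) := by
    ring
  simp only [mul_add, ← mul_div_assoc] at e3 this key ⊢
  linarith

/-- Convexity of `(u, v) ↦ √(a + (b - u)² + (c - v)²)`. -/
theorem sqrt_convex {a : ℝ} (ha : 0 ≤ a) (b p q : ℝ × ℝ) {θ : ℝ} (h0 : 0 < θ) (h1 : θ < 1) :
    Real.sqrt (a + ((b.1 - ((1 - θ) • p + θ • q).1) ^ 2 + (b.2 - ((1 - θ) • p + θ • q).2) ^ 2)) ≤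
      (1 - θ) * Real.sqrt (a + ((b.1 - p.1) ^ 2 + (b.2 - p.2) ^ 2)) +
        θ * Real.sqrt (a + ((b.1 - q.1) ^ 2 + (b.2 - q.2) ^ 2)) := by
  simp only [Prod.fst_add, Prod.snd_add, Prod.smul_fst, Prod.smul_snd, smul_eq_mul]
  have hu2 := Real.sq_sqrt (show 0 ≤ a + ((b.1 - p.1) ^ 2 + (b.2 - p.2) ^ 2) by positivity)
  have hv2 := Real.sq_sqrt (show 0 ≤ a + ((b.1 - q.1) ^ 2 + (b.2 - q.2) ^ 2) by positivity)
  have hu := Real.sqrt_nonneg (a + ((b.1 - p.1) ^ 2 + (b.2 - p.2) ^ 2))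
  have hv := Real.sqrt_nonneg (a + ((b.1 - q.1) ^ 2 + (b.2 - q.2) ^ 2))
  set u := Real.sqrt (a + ((b.1 - p.1) ^ 2 + (b.2 - p.2) ^ 2))
  set v := Real.sqrt (a + ((b.1 - q.1) ^ 2 + (b.2 - q.2) ^ 2))
  have hθ : 0 < 1 - θ := by linarith
  refine Real.sqrt_le_iff.2 ⟨by positivity, ?_⟩
  obtain ⟨x1, hx1⟩ : ∃ x, x = b.1 - p.1 := ⟨_, rfl⟩
  obtain ⟨x2, hx2⟩ : ∃ x, x = b.2 - p.2 := ⟨_, rfl⟩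
  obtain ⟨y1, hy1⟩ : ∃ x, x = b.1 - q.1 := ⟨_, rfl⟩
  obtain ⟨y2, hy2⟩ : ∃ x, x = b.2 - q.2 := ⟨_, rfl⟩
  rw [← hx1, ← hx2] at hu2
  rw [← hy1, ← hy2] at hv2
  -- Cauchy–Schwarz for `(√a, x)` and `(√a, y)`; the whole lemma is Minkowski's inequality.
  have hcs : a + (x1 * y1 + x2 * y2) ≤ u * v := by
    refine le_of_sq_le_sq_of_nonneg (by positivity) ?_
    rw [mul_pow, hu2, hv2]
    nlinarith [mul_nonneg ha (sq_nonneg (x1 - y1)), mul_nonneg ha (sq_nonneg (x2 - y2)),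
      sq_nonneg (x1 * y2 - x2 * y1)]
  have e : ((1 - θ) * u + θ * v) ^ 2 - (a + ((b.1 - ((1 - θ) * p.1 + θ * q.1)) ^ 2 +
      (b.2 - ((1 - θ) * p.2 + θ * q.2)) ^ 2)) =
      2 * (θ * (1 - θ)) * (u * v - (a + (x1 * y1 + x2 * y2))) := by
    rw [show b.1 - ((1 - θ) * p.1 + θ * q.1) = (1 - θ) * x1 + θ * y1 by rw [hx1, hy1]; ring,
      show b.2 - ((1 - θ) * p.2 + θ * q.2) = (1 - θ) * x2 + θ * y2 by rw [hx2, hy2]; ring]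
    linear_combination (1 - θ) ^ 2 * hu2 + θ ^ 2 * hv2
  have : 0 ≤ 2 * (θ * (1 - θ)) * (u * v - (a + (x1 * y1 + x2 * y2))) :=
    mul_nonneg (by positivity) (by linarith)
  linarith

end LevelSets

/-! ### Level sets of the phase in a box: transversality and curvature -/

section BoxLevelSets

/-- The phase `⟨η⟩_m + ⟨ξ - η⟩_m` in coordinates `p` of `η` and `q` of `ξ`. -/
def sumPhase (m : ℝ) (q p : ℝ × (ℝ × ℝ)) : ℝ :=
  Real.sqrt (m ^ 2 + (p.1 ^ 2 + (p.2.1 ^ 2 + p.2.2 ^ 2))) +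
    Real.sqrt (m ^ 2 + ((q.1 - p.1) ^ 2 + ((q.2.1 - p.2.1) ^ 2 + (q.2.2 - p.2.2) ^ 2)))

/-- The closed box with corner `c` and side `μ`. -/
def closedBox (c : ℝ × (ℝ × ℝ)) (μ : ℝ) : Set (ℝ × (ℝ × ℝ)) :=
  Set.Icc c.1 (c.1 + μ) ×ˢ (Set.Icc c.2.1 (c.2.1 + μ) ×ˢ Set.Icc c.2.2 (c.2.2 + μ))

theorem continuous_sumPhase (m : ℝ) (q : ℝ × (ℝ × ℝ)) : Continuous (sumPhase m q) := by
  unfold sumPhase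
  fun_prop

theorem measurableSet_sumPhase_level (m : ℝ) (q c : ℝ × (ℝ × ℝ)) (μ x y : ℝ) :
    MeasurableSet {p | p ∈ closedBox c μ ∧ x < sumPhase m q p ∧ sumPhase m q p < y} :=
  (measurableSet_Icc.prod (measurableSet_Icc.prod measurableSet_Icc)).inter
    ((measurableSet_lt measurable_const (continuous_sumPhase m q).measurable).inter
      (measurableSet_lt (continuous_sumPhase m q).measurable measurable_const))

/-- Difference of squares: `s' + s ≥ 2l`, while the two roots add up to at most `2L`. -/
theorem sqrt_add_sq_sub_ge {A l L s s' : ℝ} (hA : 0 ≤ A) (hl : 0 < l) (hs : l ≤ s) (hss : s ≤ s')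
    (h1 : Real.sqrt (A + s ^ 2) ≤ L) (h2 : Real.sqrt (A + s' ^ 2) ≤ L) :
    l / L * (s' - s) ≤ Real.sqrt (A + s' ^ 2) - Real.sqrt (A + s ^ 2) := by
  have hs0 : 0 < s := hl.trans_le hs
  have hp : 0 < Real.sqrt (A + s ^ 2) := by positivity
  have hp' : 0 ≤ Real.sqrt (A + s' ^ 2) := by positivity
  have e := Real.sq_sqrt (show 0 ≤ A + s ^ 2 by positivity)
  have e' := Real.sq_sqrt (show 0 ≤ A + s' ^ 2 by positivity)
  have hmono : Real.sqrt (A + s ^ 2) ≤ Real.sqrt (A + s' ^ 2) := by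
    apply Real.sqrt_le_sqrt
    have := pow_le_pow_left₀ hs0.le hss 2
    linarith
  set J := Real.sqrt (A + s ^ 2)
  set J' := Real.sqrt (A + s' ^ 2)
  have hL : 0 < L := hp.trans_le h1
  rw [div_mul_eq_mul_div, div_le_iff₀ hL]
  have h3 : (J' - J) * (J' + J) ≤ (J' - J) * (2 * L) :=
    mul_le_mul_of_nonneg_left (by linarith) (by linarith)
  have h4 : (s' - s) * (2 * l) ≤ (s' - s) * (s' + s) :=
    mul_le_mul_of_nonneg_left (by linarith) (by linarith)
  nlinarith

/-- Where the first coordinate dominates both `ξ` and the oscillation of the box, the phase is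
monotone in that coordinate. -/
theorem volume_level_transversal_le {m l L μ x y : ℝ} {q c : ℝ × (ℝ × ℝ)} (hl : 0 < l)
    (hμ : 0 ≤ μ) (hxy : x < y)
    (hc : (∀ s ∈ Set.Icc c.1 (c.1 + μ), l ≤ s) ∨ ∀ s ∈ Set.Icc c.1 (c.1 + μ), s ≤ -l)
    (hq : |q.1| ≤ l)
    (hL : ∀ p ∈ closedBox c μ, Real.sqrt (m ^ 2 + (p.1 ^ 2 + (p.2.1 ^ 2 + p.2.2 ^ 2))) ≤ L) :
    volume {p | p ∈ closedBox c μ ∧ x < sumPhase m q p ∧ sumPhase m q p < y} ≤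
      ENNReal.ofReal (L / l * μ ^ 2 * (y - x)) := by
  set T := {p | p ∈ closedBox c μ ∧ x < sumPhase m q p ∧ sumPhase m q p < y} with hT
  rcases T.eq_empty_or_nonempty with hTe | ⟨p₀, hp₀⟩
  · rw [hTe]; simp
  have hL0 : 0 ≤ L := (Real.sqrt_nonneg _).trans (hL p₀ hp₀.1)
  -- As `s` keeps a sign and `|q.1| ≤ l ≤ |s|`, the quantities `|s|` and `|q.1 - s|` grow together.
  -- The second bracket thus reinforces the first, which alone has slope at least `l/L`.
  have hslice : ∀ v : ℝ × ℝ, ∀ s s' : ℝ, s ≤ s' → (s, v) ∈ T → (s', v) ∈ T →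
      s' - s ≤ L / l * (y - x) := by
    intro v s s' hss ⟨hs, h1, h2⟩ ⟨hs', h1', h2'⟩
    have hLs := hL _ hs
    have hLs' := hL _ hs'
    have hq' := abs_le.1 hq
    simp only [sumPhase] at h1 h2 h1' h2' hLs hLs'
    have key : l / L * (s' - s) ≤ y - x := by
      rcases hc with hc | hc
      · have a1 := sqrt_add_sq_sub_ge (A := m ^ 2 + (v.1 ^ 2 + v.2 ^ 2)) (L := L) (by positivity)
          hl (hc s hs.1) hss (by convert hLs using 2; ring) (by convert hLs' using 2; ring)
        have b1 := hc s hs.1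
        have a2 : Real.sqrt (m ^ 2 + ((q.1 - s) ^ 2 + ((q.2.1 - v.1) ^ 2 + (q.2.2 - v.2) ^ 2))) ≤
            Real.sqrt (m ^ 2 + ((q.1 - s') ^ 2 + ((q.2.1 - v.1) ^ 2 + (q.2.2 - v.2) ^ 2))) := by
          apply Real.sqrt_le_sqrt
          nlinarith
        rw [show m ^ 2 + (v.1 ^ 2 + v.2 ^ 2) + s' ^ 2 = m ^ 2 + (s' ^ 2 + (v.1 ^ 2 + v.2 ^ 2)) by
          ring, show m ^ 2 + (v.1 ^ 2 + v.2 ^ 2) + s ^ 2 = m ^ 2 + (s ^ 2 + (v.1 ^ 2 + v.2 ^ 2)) by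
          ring] at a1
        linarith
      · have a1 := sqrt_add_sq_sub_ge (A := m ^ 2 + (v.1 ^ 2 + v.2 ^ 2)) (L := L) (s := -s')
          (s' := -s) (by positivity) hl (by linarith [hc s' hs'.1]) (by linarith)
          (by convert hLs' using 2; ring) (by convert hLs using 2; ring)
        have b1 := hc s' hs'.1
        have a2 : Real.sqrt (m ^ 2 + ((q.1 - s') ^ 2 + ((q.2.1 - v.1) ^ 2 + (q.2.2 - v.2) ^ 2))) ≤
            Real.sqrt (m ^ 2 + ((q.1 - s) ^ 2 + ((q.2.1 - v.1) ^ 2 + (q.2.2 - v.2) ^ 2))) := by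
          apply Real.sqrt_le_sqrt
          nlinarith
        rw [show m ^ 2 + (v.1 ^ 2 + v.2 ^ 2) + (-s') ^ 2 = m ^ 2 + (s' ^ 2 + (v.1 ^ 2 + v.2 ^ 2)) by
          ring, show m ^ 2 + (v.1 ^ 2 + v.2 ^ 2) + (-s) ^ 2 =
          m ^ 2 + (s ^ 2 + (v.1 ^ 2 + v.2 ^ 2)) by ring,
          show -s - -s' = s' - s by ring] at a1
        linarith
    rcases hL0.eq_or_lt with h0 | h0
    -- `L = 0` would force `s = 0`, against `l ≤ |s|`.
    · exfalso
      have hs2 : 0 < s ^ 2 := by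
        rcases hc with hc | hc
        · nlinarith [hc s hs.1]
        · nlinarith [hc s hs.1]
      rw [← h0, Real.sqrt_le_left le_rfl] at hLs
      nlinarith [sq_nonneg m, sq_nonneg v.1, sq_nonneg v.2]
    · rw [div_mul_eq_mul_div, div_le_iff₀ h0] at key
      rw [div_mul_eq_mul_div, le_div_iff₀ hl]
      linarith
  have hdiam : ∀ v : ℝ × ℝ, volume ((fun s => (s, v)) ⁻¹' T) ≤
      (Set.Icc c.2.1 (c.2.1 + μ) ×ˢ Set.Icc c.2.2 (c.2.2 + μ)).indicator
        (fun _ => ENNReal.ofReal (L / l * (y - x))) v := by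
    intro v
    by_cases hv : v ∈ Set.Icc c.2.1 (c.2.1 + μ) ×ˢ Set.Icc c.2.2 (c.2.2 + μ)
    · rw [Set.indicator_of_mem hv]
      refine (Real.volume_le_diam _).trans (Metric.ediam_le fun s hs s' hs' => ?_)
      rw [edist_dist, Real.dist_eq]
      apply ENNReal.ofReal_le_ofReal
      rcases le_total s s' with h | h
      · rw [abs_sub_comm, abs_of_nonneg (by linarith)]
        exact hslice v s s' h hs hs'
      · rw [abs_of_nonneg (by linarith)]
        exact hslice v s' s h hs' hs
    · have : (fun s : ℝ => (s, v)) ⁻¹' T = ∅ := by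
        ext s
        simp only [Set.mem_preimage, Set.mem_empty_iff_false, iff_false]
        exact fun h => hv h.1.2
      rw [this]
      simp
  rw [Measure.volume_eq_prod, Measure.prod_apply_symm (measurableSet_sumPhase_level m q c μ x y)]
  refine (lintegral_mono hdiam).trans ?_
  rw [lintegral_indicator (measurableSet_Icc.prod measurableSet_Icc), setLIntegral_const,
    Measure.volume_eq_prod, Measure.prod_prod, Real.volume_Icc, Real.volume_Icc,
    add_sub_cancel_left, add_sub_cancel_left, ← ENNReal.ofReal_mul hμ,
    ← ENNReal.ofReal_mul (by have := sub_pos.2 hxy; positivity)]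
  exact le_of_eq (congrArg _ (by ring))

/-- Where the first coordinate is bounded below, the phase is strongly convex in the other two. -/
theorem volume_level_curved_le {m l L μ x y : ℝ} {q c : ℝ × (ℝ × ℝ)} (hl : 0 < l)
    (hμ : 0 ≤ μ) (hxy : x < y) (hc : ∀ s ∈ Set.Icc c.1 (c.1 + μ), l ≤ |s|)
    (hL : ∀ p ∈ closedBox c μ, Real.sqrt (m ^ 2 + (p.1 ^ 2 + (p.2.1 ^ 2 + p.2.2 ^ 2))) ≤ L) :
    volume {p | p ∈ closedBox c μ ∧ x < sumPhase m q p ∧ sumPhase m q p < y} ≤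
      ENNReal.ofReal (2 * Real.pi * (L ^ 3 / l ^ 2) * μ * (y - x)) := by
  set T := {p | p ∈ closedBox c μ ∧ x < sumPhase m q p ∧ sumPhase m q p < y} with hT
  set Q := Set.Icc c.2.1 (c.2.1 + μ) ×ˢ Set.Icc c.2.2 (c.2.2 + μ) with hQ
  have hQk : IsCompact Q := isCompact_Icc.prod isCompact_Icc
  have hQc : Convex ℝ Q := (convex_Icc _ _).prod (convex_Icc _ _)
  have hL0 : 0 ≤ L := by
    refine (Real.sqrt_nonneg _).trans (hL c ?_)
    simp [closedBox, Prod.le_def, hμ]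
  have hslice : ∀ s : ℝ, volume (Prod.mk s ⁻¹' T) ≤
      (Set.Icc c.1 (c.1 + μ)).indicator
        (fun _ => ENNReal.ofReal (2 * Real.pi * (L ^ 3 / l ^ 2) * (y - x))) s := by
    intro s
    by_cases hs : s ∈ Set.Icc c.1 (c.1 + μ)
    · rw [Set.indicator_of_mem hs]
      have hs2 : l ^ 2 ≤ s ^ 2 := by
        rw [← sq_abs s]
        exact pow_le_pow_left₀ hl.le (hc s hs) 2
      -- On the slice at height `s` the bracket is a planar one with effective mass `a ≥ l > 0`,
      -- even when `m = 0`; hence the modulus `a²/L³ ≥ l²/L³`.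
      set a := Real.sqrt (m ^ 2 + s ^ 2) with ha
      have ha2 : a ^ 2 = m ^ 2 + s ^ 2 := Real.sq_sqrt (by positivity)
      have hla : l ^ 2 ≤ a ^ 2 := by nlinarith [sq_nonneg m]
      have ha0 : 0 < a := Real.sqrt_pos.2 (by nlinarith [sq_nonneg m])
      have hLQ : ∀ v ∈ Q, Real.sqrt (a ^ 2 + (v.1 ^ 2 + v.2 ^ 2)) ≤ L := by
        intro v hv
        rw [ha2, add_assoc]
        exact hL (s, v) ⟨hs, hv⟩
      have hLpos : 0 < L := by
        refine lt_of_lt_of_le ?_ (hLQ c.2 (by simp [hQ, Prod.le_def, hμ]))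
        positivity
      have hκ : 0 < a ^ 2 / L ^ 3 := by positivity
      have h := volume_level_strongConvex_le hQk hQc (f := fun v => sumPhase m q (s, v))
        ((continuous_sumPhase m q).comp (by fun_prop)) hκ ?_ hxy
      · have e : Prod.mk s ⁻¹' T = {v | v ∈ Q ∧ x < sumPhase m q (s, v) ∧
            sumPhase m q (s, v) < y} := by
          ext v
          simp only [hT, Set.mem_preimage, Set.mem_ofPred_eq, closedBox, Set.mem_prod, hs, hQ,
            true_and]
        rw [e]
        refine h.trans (ENNReal.ofReal_le_ofReal ?_)
        have := sub_pos.2 hxy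
        refine mul_le_mul_of_nonneg_right ?_ this.le
        rw [div_div_eq_mul_div, mul_div_assoc]
        gcongr
      · intro v hv w hw θ h0 h1
        have hz := hQc hv hw (by linarith : 0 ≤ 1 - θ) h0.le (by ring)
        have e1 := sqrt_strongConvex ha0 h0 h1 (hLQ v hv) (hLQ w hw) (hLQ _ hz)
        -- Convexity of the second bracket is enough, so `ξ` is unconstrained.
        have e2 := sqrt_convex (a := m ^ 2 + (q.1 - s) ^ 2) (by positivity) q.2 v w h0 h1
        simp only [ha2, add_assoc] at e1 e2
        simp only [sumPhase, ha2]
        linarith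
    · have : Prod.mk s ⁻¹' T = ∅ := by
        ext v
        simp only [Set.mem_preimage, Set.mem_empty_iff_false, iff_false]
        exact fun h => hs h.1.1
      rw [this]
      simp
  rw [Measure.volume_eq_prod, Measure.prod_apply (measurableSet_sumPhase_level m q c μ x y)]
  refine (lintegral_mono hslice).trans ?_
  rw [lintegral_indicator measurableSet_Icc, setLIntegral_const, Real.volume_Icc,
    add_sub_cancel_left, ← ENNReal.ofReal_mul (by have := sub_pos.2 hxy; positivity)]
  exact le_of_eq (congrArg _ (by ring))

end BoxLevelSets

/-! ### Frequency cubes and the choice of a dominant coordinate -/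

section Coordinates

/-- Coordinates of `ℝ³` with the `i`-th one singled out. -/
def coords (i : Fin 3) (ξ : R3) : ℝ × (ℝ × ℝ) := (ξ i, (ξ (i.succAbove 0), ξ (i.succAbove 1)))

theorem measurePreserving_coords (i : Fin 3) : MeasurePreserving (coords i) volume volume := by
  have h1 := PiLp.volume_preserving_ofLp (Fin 3)
  have h2 := volume_preserving_piFinSuccAbove (fun _ : Fin 3 => ℝ) i
  have h3 := (MeasurePreserving.id (volume : Measure ℝ)).prod (volume_preserving_finTwoArrow ℝ)
  exact h3.comp (h2.comp h1)

theorem norm_sq_eq_coords (i : Fin 3) (ξ : R3) :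
    ‖ξ‖ ^ 2 = (coords i ξ).1 ^ 2 + ((coords i ξ).2.1 ^ 2 + (coords i ξ).2.2 ^ 2) := by
  rw [EuclideanSpace.real_norm_sq_eq, Fin.sum_univ_succAbove _ i, Fin.sum_univ_two]
  rfl

theorem jap_add_jap_eq_sumPhase (m : ℝ) (i : Fin 3) (ξ η : R3) :
    jap m η + jap m (ξ - η) = sumPhase m (coords i ξ) (coords i η) := by
  rw [jap, jap, norm_sq_eq_coords i, norm_sq_eq_coords i (ξ - η)]
  rfl

/-- The frequencies in the cube `C_z` of size comparable to `l`. -/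
def shellCube (μ l : ℝ) (z : Fin 3 → ℤ) : Set R3 :=
  {η | η ∈ cube μ z ∧ l / 2 ≤ ‖η‖ ∧ ‖η‖ ≤ 2 * l}

theorem measurableSet_shellCube (μ l : ℝ) (z : Fin 3 → ℤ) : MeasurableSet (shellCube μ l z) :=
  (measurableSet_cube μ z).inter ((measurableSet_le measurable_const measurable_norm).inter
    (measurableSet_le measurable_norm measurable_const))

/-- A point of norm at least `l/2` has a coordinate of size at least `l/4`; moving within a cube of
side `μ ≤ l/20` keeps it above `l/8` with the same sign. All coordinates stay below `2l + l/20 ≤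
3l`, and `m² + 27l² ≤ ((m+6)l)²` because `l ≥ 1`. -/
theorem exists_dominant_coordinate {m μ l : ℝ} {z : Fin 3 → ℤ} (hm : 0 ≤ m) (hμ : 0 < μ)
    (hμl : 20 * μ ≤ l) (hl : 1 ≤ l) (hne : (shellCube μ l z).Nonempty) :
    ∃ (i : Fin 3) (c : ℝ × (ℝ × ℝ)), (∀ η ∈ cube μ z, coords i η ∈ closedBox c μ) ∧
      ((∀ s ∈ Set.Icc c.1 (c.1 + μ), l / 8 ≤ s) ∨ ∀ s ∈ Set.Icc c.1 (c.1 + μ), s ≤ -(l / 8)) ∧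
      ∀ p ∈ closedBox c μ,
        Real.sqrt (m ^ 2 + (p.1 ^ 2 + (p.2.1 ^ 2 + p.2.2 ^ 2))) ≤ (m + 6) * l := by
  obtain ⟨η₀, hη₀, hlow, hup⟩ := hne
  have hbig : ∃ i, l / 4 ≤ |η₀ i| := by
    by_contra! h
    have hs : ‖η₀‖ ^ 2 = η₀ 0 ^ 2 + η₀ 1 ^ 2 + η₀ 2 ^ 2 := by
      rw [EuclideanSpace.real_norm_sq_eq, Fin.sum_univ_three]
    have hb : ∀ i, η₀ i ^ 2 ≤ (l / 4) ^ 2 := fun i => by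
      rw [← sq_abs]
      exact pow_le_pow_left₀ (abs_nonneg _) (h i).le 2
    have := pow_le_pow_left₀ (by positivity) hlow 2
    nlinarith [hb 0, hb 1, hb 2]
  have hcoord : ∀ j, |η₀ j| ≤ 2 * l := fun j => by
    refine le_trans ?_ hup
    simpa using PiLp.norm_apply_le η₀ j
  obtain ⟨i, hi⟩ := hbig
  refine ⟨i, (μ * z i, (μ * z (i.succAbove 0), μ * z (i.succAbove 1))), ?_, ?_, ?_⟩
  · intro η hη
    exact ⟨⟨(hη i).1, (hη i).2.le⟩, ⟨(hη _).1, (hη _).2.le⟩, ⟨(hη _).1, (hη _).2.le⟩⟩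
  · have h0 := hη₀ i
    rcases le_abs.1 hi with h | h
    · left
      rintro s ⟨h1, h2⟩
      simp only at h1 h2
      linarith
    · right
      rintro s ⟨h1, h2⟩
      simp only at h1 h2
      linarith
  · rintro ⟨p1, p2, p3⟩ ⟨⟨h1, h1'⟩, ⟨h2, h2'⟩, ⟨h3, h3'⟩⟩
    simp only at h1 h1' h2 h2' h3 h3' ⊢
    have key : ∀ (j : Fin 3) (s : ℝ), μ * z j ≤ s → s ≤ μ * z j + μ → s ^ 2 ≤ (3 * l) ^ 2 := by
      intro j s hs hs'
      have h0 := hη₀ j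
      have h4 := abs_le.1 (hcoord j)
      exact sq_le_sq' (by linarith) (by linarith)
    have e1 := key i p1 h1 h1'
    have e2 := key _ p2 h2 h2'
    have e3 := key _ p3 h3 h3'
    refine Real.sqrt_le_iff.2 ⟨by positivity, ?_⟩
    have : m ^ 2 ≤ m ^ 2 * l ^ 2 := le_mul_of_one_le_right (sq_nonneg m) (one_le_pow₀ hl)
    nlinarith [mul_nonneg hm (sq_nonneg l)]

/-- The exact factor is `(2π)⁻³`; only that it is at most one is kept. -/
theorem volume_preimage_two_pi_smul_le (S : Set R3) :
    volume ((fun η : R3 => (2 * Real.pi) • η) ⁻¹' S) ≤ volume S := by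
  rw [Measure.addHaar_preimage_smul _ (by positivity : (2 * Real.pi) ≠ 0)]
  refine mul_le_of_le_one_left (zero_le) ?_
  rw [ENNReal.ofReal_le_one, finrank_euclideanSpace_fin, abs_of_pos (by positivity)]
  refine inv_le_one_of_one_le₀ (one_le_pow₀ ?_)
  linarith [Real.pi_gt_three]

/-- Shared reduction for the two level-set bounds: it transfers an estimate on boxes with a dominant
first coordinate to the shell part of a cube, whichever coordinate dominates there. -/
theorem volume_coords_level_le {m μ l x y B : ℝ} {z : Fin 3 → ℤ} (hm : 0 ≤ m) (hμ : 0 < μ)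
    (hμl : 20 * μ ≤ l) (hl : 1 ≤ l) (ξ : R3)
    (hB : ∀ (i : Fin 3) (c : ℝ × (ℝ × ℝ)),
      ((∀ s ∈ Set.Icc c.1 (c.1 + μ), l / 8 ≤ s) ∨ ∀ s ∈ Set.Icc c.1 (c.1 + μ), s ≤ -(l / 8)) →
      (∀ p ∈ closedBox c μ,
        Real.sqrt (m ^ 2 + (p.1 ^ 2 + (p.2.1 ^ 2 + p.2.2 ^ 2))) ≤ (m + 6) * l) →
      volume {p | p ∈ closedBox c μ ∧ x < sumPhase m (coords i ξ) p ∧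
        sumPhase m (coords i ξ) p < y} ≤ ENNReal.ofReal B) :
    volume {η : R3 | (2 * Real.pi) • η ∈ shellCube μ l z ∧
      x < jap m ((2 * Real.pi) • η) + jap m (ξ - (2 * Real.pi) • η) ∧
      jap m ((2 * Real.pi) • η) + jap m (ξ - (2 * Real.pi) • η) < y} ≤ ENNReal.ofReal B := by
  refine (volume_preimage_two_pi_smul_le {η | η ∈ shellCube μ l z ∧
    x < jap m η + jap m (ξ - η) ∧ jap m η + jap m (ξ - η) < y}).trans ?_
  rcases (shellCube μ l z).eq_empty_or_nonempty with he | hne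
  · simp [he]
  obtain ⟨i, c, h1, h2, h3⟩ := exists_dominant_coordinate hm hμ hμl hl hne
  refine le_trans ?_ (hB i c h2 h3)
  rw [← (measurePreserving_coords i).measure_preimage
    (measurableSet_sumPhase_level m _ c μ x y).nullMeasurableSet]
  refine measure_mono ?_
  rintro η ⟨hη, hx, hy⟩
  rw [jap_add_jap_eq_sumPhase m i] at hx hy
  exact ⟨h1 η hη.1, hx, hy⟩

/-- Level sets of `⟨η⟩ + ⟨ξ - η⟩` in a cube at frequency `l ≫ μ`, for small `ξ`. -/
theorem volume_level_low_output_le {m μ l x y : ℝ} {z : Fin 3 → ℤ} (hm : 0 ≤ m) (hμ : 0 < μ)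
    (hμl : 20 * μ ≤ l) (hl : 1 ≤ l) (hxy : x < y) {ξ : R3} (hξ : ‖ξ‖ ≤ 2 * μ) :
    volume {η : R3 | (2 * Real.pi) • η ∈ shellCube μ l z ∧
      x < jap m ((2 * Real.pi) • η) + jap m (ξ - (2 * Real.pi) • η) ∧
      jap m ((2 * Real.pi) • η) + jap m (ξ - (2 * Real.pi) • η) < y} ≤
      ENNReal.ofReal (8 * (m + 6) * μ ^ 2 * (y - x)) := by
  refine volume_coords_level_le hm hμ hμl hl ξ fun i c h2 h3 => ?_
  have hq : |(coords i ξ).1| ≤ l / 8 := by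
    have : |ξ i| ≤ ‖ξ‖ := by simpa using PiLp.norm_apply_le ξ i
    simp only [coords]
    linarith
  refine (volume_level_transversal_le (by linarith : 0 < l / 8) hμ.le hxy h2 hq h3).trans
    (le_of_eq (congrArg _ ?_))
  field_simp

/-- Level sets of `⟨η⟩ + ⟨ξ - η⟩` in a cube of side `μ` at frequency `l ≫ μ`. -/
theorem volume_level_le {m μ l x y : ℝ} {z : Fin 3 → ℤ} (hm : 0 ≤ m) (hμ : 0 < μ)
    (hμl : 20 * μ ≤ l) (hl : 1 ≤ l) (hxy : x < y) (ξ : R3) :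
    volume {η : R3 | (2 * Real.pi) • η ∈ shellCube μ l z ∧
      x < jap m ((2 * Real.pi) • η) + jap m (ξ - (2 * Real.pi) • η) ∧
      jap m ((2 * Real.pi) • η) + jap m (ξ - (2 * Real.pi) • η) < y} ≤
      ENNReal.ofReal (128 * Real.pi * (m + 6) ^ 3 * (μ * l) * (y - x)) := by
  refine volume_coords_level_le hm hμ hμl hl ξ fun i c h2 h3 => ?_
  have h2' : ∀ s ∈ Set.Icc c.1 (c.1 + μ), l / 8 ≤ |s| := fun s hs => by
    rcases h2 with h | h
    · exact (h s hs).trans (le_abs_self s)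
    · exact le_trans (by linarith [h s hs]) (neg_le_abs s)
  refine (volume_level_curved_le (by linarith : 0 < l / 8) hμ.le hxy h2' h3).trans
    (le_of_eq (congrArg _ ?_))
  field_simp
  ring

end Coordinates

/-! ### Frequency supports of the localized inputs -/

section Multipliers

theorem coeFn_fourier_multiplier {σ : R3 → ℂ} (hσ : Measurable σ) (hb : ∃ C, ∀ ξ, ‖σ ξ‖ ≤ C)
    (f : L2) : (𝓕 (multiplier σ hσ hb f) : L2) =ᵐ[volume]
      fun ξ => σ ((2 * Real.pi) • ξ) * (𝓕 f : L2) ξ := by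
  rw [multiplier, FourierTransform.fourier_fourierInv_eq]
  exact MemLp.coeFn_toLp _

theorem Cutoff.eq_zero (χ : Cutoff) {s : ℝ} (hs : 2 ≤ |s|) : χ.toFun s = 0 := by
  by_contra h
  have := χ.support (subset_tsupport _ h)
  rcases le_abs.1 hs with h1 | h1 <;> linarith [this.1, this.2]

theorem rho_eq_zero_of_le (χ : Cutoff) {l s : ℝ} (hs : 2 * l ≤ |s|) : rho χ l s = 0 := by
  unfold rho
  split_ifs with h1 h2
  · rfl
  · exact χ.eq_zero (by linarith)
  · have hl : 0 < l := by linarith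
    have e1 : 2 ≤ |s / l| := by rw [abs_div, abs_of_pos hl, le_div_iff₀ hl]; exact hs
    have e2 : 2 ≤ |2 * s / l| := by
      rw [abs_div, abs_of_pos hl, le_div_iff₀ hl, abs_mul, abs_of_pos (by norm_num : (0 : ℝ) < 2)]
      linarith
    rw [χ.eq_zero e1, χ.eq_zero e2, sub_zero]

theorem rho_eq_zero_of_le_half (χ : Cutoff) {l s : ℝ} (hl : 1 < l) (hs : |s| ≤ l / 2) :
    rho χ l s = 0 := by
  have hl0 : 0 < l := by linarith
  rw [rho, if_neg (by linarith), if_neg (by linarith), χ.eq_one, χ.eq_one, sub_self]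
  · rw [abs_div, abs_of_pos hl0, div_le_one hl0, abs_mul, abs_of_pos (by norm_num : (0 : ℝ) < 2)]
    linarith
  · rw [abs_div, abs_of_pos hl0, div_le_one hl0]
    linarith

theorem Cutoff.exists_rho_bound (χ : Cutoff) : ∃ C, 1 ≤ C ∧ ∀ l s, |rho χ l s| ≤ C := by
  obtain ⟨C, hC⟩ := χ.exists_bound
  have h1 : 1 ≤ C := by
    have := hC 0
    rwa [χ.eq_one 0 (by simp), abs_one] at this
  refine ⟨C + C, by linarith, fun l s => ?_⟩
  unfold rho
  split_ifs
  · simp only [abs_zero]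
    linarith
  · linarith [hC s]
  · exact (abs_sub _ _).trans (add_le_add (hC _) (hC _))

theorem fourier_localized_eq_zero_of_large (χ : Cutoff) (μ l : ℝ) (z : Fin 3 → ℤ) (f : L2) :
    ∀ᵐ ξ : R3, 2 * l ≤ ‖(2 * Real.pi) • ξ‖ → (𝓕 (localized χ μ l z f) : L2) ξ = 0 := by
  filter_upwards [coeFn_fourier_multiplier _ _ (freqProj χ l f),
    coeFn_fourier_multiplier (measurable_rho_symbol χ l) (bound_rho_symbol χ l) f] with ξ h1 h2 h
  rw [localized, cubeProj, h1, freqProj, h2, rho_eq_zero_of_le χ (by rwa [abs_norm])]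
  simp

theorem fourier_localized_eq_zero (χ : Cutoff) {μ l : ℝ} (hl : 1 < l) (z : Fin 3 → ℤ) (f : L2) :
    ∀ᵐ ξ : R3, (2 * Real.pi) • ξ ∉ shellCube μ l z → (𝓕 (localized χ μ l z f) : L2) ξ = 0 := by
  filter_upwards [coeFn_fourier_multiplier _ _ (freqProj χ l f),
    coeFn_fourier_multiplier (measurable_rho_symbol χ l) (bound_rho_symbol χ l) f] with ξ h1 h2 h
  rw [localized, cubeProj, h1]
  by_cases hc : (2 * Real.pi) • ξ ∈ cube μ z
  · rw [freqProj, h2]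
    have : rho χ l ‖(2 * Real.pi) • ξ‖ = 0 := by
      rcases le_or_gt (2 * l) ‖(2 * Real.pi) • ξ‖ with h3 | h3
      · exact rho_eq_zero_of_le χ (by rwa [abs_norm])
      · refine rho_eq_zero_of_le_half χ hl ?_
        rw [abs_norm]
        by_contra! h4
        exact h ⟨hc, h4.le, h3.le⟩
    rw [this]
    simp
  · rw [Set.indicator_of_notMem hc, zero_mul]

/-- An `L²` function with bounded frequency support has integrable Fourier transform. -/
theorem integrable_of_ae_eq_zero_off_ball {F : L2} {R : ℝ}
    (h : ∀ᵐ ξ : R3, R ≤ ‖(2 * Real.pi) • ξ‖ → F ξ = 0) : Integrable F := by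
  have hind : (Metric.closedBall (0 : R3) R).indicator F =ᵐ[volume] F := by
    filter_upwards [h] with ξ hξ
    by_cases hb : ξ ∈ Metric.closedBall (0 : R3) R
    · rw [Set.indicator_of_mem hb]
    · rw [Set.indicator_of_notMem hb, hξ]
      rw [mem_closedBall_zero_iff, not_le] at hb
      rw [norm_smul, Real.norm_of_nonneg (by positivity)]
      have : 1 * ‖ξ‖ ≤ 2 * Real.pi * ‖ξ‖ :=
        mul_le_mul_of_nonneg_right (by linarith [Real.pi_gt_three]) (norm_nonneg _)
      linarith
  refine Integrable.congr ?_ hind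
  rw [integrable_indicator_iff measurableSet_closedBall]
  have : IsFiniteMeasure (volume.restrict (Metric.closedBall (0 : R3) R)) :=
    ⟨by rw [Measure.restrict_apply_univ]; exact measure_closedBall_lt_top⟩
  exact ((Lp.memLp F).restrict _).integrable (by norm_num)

end Multipliers

/-! ### The interaction on the Fourier side -/

section Interaction

/-- The phase of the product of two propagators, at output frequency `ξ`. -/
def bracketSum (m ε : ℝ) (ξ η : R3) : ℝ :=
  jap m ((2 * Real.pi) • η) + ε * jap m ((2 * Real.pi) • (ξ - η))

/-- The spatial Fourier transform of `S_m(t) a · S_m(ε t) b`. -/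
def productFourier (m ε : ℝ) (a b : L2) (t : ℝ) (ξ : R3) : ℂ :=
  oscIntegral volume (bracketSum m ε ξ) (fun η => (𝓕 a : L2) η * (𝓕 b : L2) (ξ - η)) t

theorem measurable_jap (m : ℝ) : Measurable (jap m) := by
  unfold jap
  fun_prop

theorem measurable_bracketSum (m ε : ℝ) (ξ : R3) : Measurable (bracketSum m ε ξ) := by
  unfold bracketSum jap
  fun_prop

theorem coeFn_fourier_propagator (m t : ℝ) (a : L2) :
    (𝓕 (propagator m t a) : L2) =ᵐ[volume] fun ξ =>
      Complex.exp (-Complex.I * ((t * jap m ((2 * Real.pi) • ξ) : ℝ) : ℂ)) * (𝓕 a : L2) ξ :=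
  coeFn_fourier_multiplier _ _ a

/-- The propagators multiply the two convolution factors by unimodular exponentials, whose phases
add up to `t · bracketSum`. -/
theorem fourier_propagator_mul (m ε : ℝ) (a b : L2) (t : ℝ) :
    𝓕 (fun x => propagator m t a x * propagator m (ε * t) b x) = productFourier m ε a b t := by
  ext ξ
  rw [fourier_mul_eq_convolution, productFourier, oscIntegral]
  refine integral_congr_ae ?_
  filter_upwards [coeFn_fourier_propagator m t a,
    (measurePreserving_sub_left_volume ξ).quasiMeasurePreserving.ae_eq_comp
      (coeFn_fourier_propagator m (ε * t) b)] with η h1 h2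
  simp only [Function.comp_apply] at h2
  rw [h1, h2, bracketSum, mul_add, Complex.ofReal_add, mul_add, Complex.exp_add,
    show t * (ε * jap m ((2 * Real.pi) • (ξ - η))) = ε * t * jap m ((2 * Real.pi) • (ξ - η)) by
      ring]
  ring

theorem stronglyMeasurable_productFourier (m ε : ℝ) (a b : L2) :
    StronglyMeasurable fun p : ℝ × R3 => productFourier m ε a b p.1 p.2 := by
  have ha : Measurable (𝓕 a : L2) := (Lp.stronglyMeasurable _).measurable
  have hb : Measurable (𝓕 b : L2) := (Lp.stronglyMeasurable _).measurable
  have hj := measurable_jap m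
  have h : Measurable fun q : (ℝ × R3) × R3 =>
      Complex.exp (-Complex.I * ((q.1.1 * bracketSum m ε q.1.2 q.2 : ℝ) : ℂ)) *
        ((𝓕 a : L2) q.2 * (𝓕 b : L2) (q.1.2 - q.2)) := by
    unfold bracketSum
    fun_prop
  exact h.stronglyMeasurable.integral_prod_right'

theorem measurable_rho_scaled (χ : Cutoff) (μ : ℝ) :
    Measurable fun ξ : R3 => ((rho χ μ ‖(2 * Real.pi) • ξ‖ : ℝ) : ℂ) :=
  Complex.measurable_ofReal.comp
    ((rho_continuous χ μ).measurable.comp (measurable_const_smul (2 * Real.pi)).norm)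

theorem stronglyMeasurable_interaction (χ : Cutoff) (m μ ε : ℝ) (a b : L2) :
    StronglyMeasurable (interaction χ m μ ε a b) := by
  have hw := (stronglyMeasurable_productFourier m ε a b).measurable
  have h : Measurable fun q : (ℝ × R3) × R3 =>
      Complex.exp ((2 * Real.pi * inner ℝ q.2 q.1.2 : ℝ) * Complex.I) •
        (((rho χ μ ‖(2 * Real.pi) • q.2‖ : ℝ) : ℂ) * productFourier m ε a b q.1.1 q.2) := by
    have h1 : Measurable fun q : (ℝ × R3) × R3 =>
        ((rho χ μ ‖(2 * Real.pi) • q.2‖ : ℝ) : ℂ) :=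
      (measurable_rho_scaled χ μ).comp measurable_snd
    have hg : Measurable fun q : (ℝ × R3) × R3 => (q.1.1, q.2) := by fun_prop
    have h2 := hw.comp hg
    simp only [Function.comp_def] at h2
    fun_prop
  have e : interaction χ m μ ε a b = fun p : ℝ × R3 => ∫ ξ : R3,
      Complex.exp ((2 * Real.pi * inner ℝ ξ p.2 : ℝ) * Complex.I) •
        (((rho χ μ ‖(2 * Real.pi) • ξ‖ : ℝ) : ℂ) * productFourier m ε a b p.1 ξ) := by
    ext p
    rw [interaction, freqProjL1, fourier_propagator_mul, Real.fourierInv_eq']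
  rw [e]
  exact h.stronglyMeasurable.integral_prod_right'

theorem norm_productFourier_le (m ε : ℝ) (a b : L2) (t : ℝ) (ξ : R3) :
    ‖productFourier m ε a b t ξ‖ ≤ ∫ x, ‖propagator m t a x * propagator m (ε * t) b x‖ := by
  rw [← fourier_propagator_mul]
  exact VectorFourier.norm_fourierIntegral_le_integral_norm _ _ _ _ _

theorem eLpNorm_two_sq {α E : Type*} [MeasurableSpace α] [NormedAddCommGroup E] (ν : Measure α)
    (f : α → E) : eLpNorm f 2 ν ^ 2 = ∫⁻ x, ‖f x‖ₑ ^ 2 ∂ν := by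
  have h := eLpNorm_nnreal_pow_eq_lintegral (f := f) (μ := ν) (p := 2) two_ne_zero
  simpa using h

/-- Bounded with bounded support. The exponents 1 and 2 are the ones needed, to apply Plancherel to
the inverse Fourier integral. -/
theorem memLp_rho_mul_productFourier (χ : Cutoff) (m μ ε : ℝ) (a b : L2) (t : ℝ) (p : ℝ≥0∞) :
    MemLp (fun ξ : R3 => ((rho χ μ ‖(2 * Real.pi) • ξ‖ : ℝ) : ℂ) * productFourier m ε a b t ξ)
      p volume := by
  obtain ⟨C, hC1, hC⟩ := χ.exists_rho_bound
  have hm : Measurable (fun ξ : R3 => ((rho χ μ ‖(2 * Real.pi) • ξ‖ : ℝ) : ℂ) *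
      productFourier m ε a b t ξ) := by
    refine (measurable_rho_scaled χ μ).mul ?_
    have h2 := (stronglyMeasurable_productFourier m ε a b).measurable.comp
      (measurable_prodMk_left (x := t))
    exact h2
  have htop : MemLp (fun ξ : R3 => ((rho χ μ ‖(2 * Real.pi) • ξ‖ : ℝ) : ℂ) *
      productFourier m ε a b t ξ) ∞ volume := by
    refine memLp_top_of_bound hm.aestronglyMeasurable
      (C * ∫ x, ‖propagator m t a x * propagator m (ε * t) b x‖)
      (Filter.Eventually.of_forall fun ξ => ?_)
    rw [norm_mul, Complex.norm_real, Real.norm_eq_abs]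
    exact mul_le_mul (hC _ _) (norm_productFourier_le m ε a b t ξ) (norm_nonneg _) (by linarith)
  set B := Metric.closedBall (0 : R3) (2 * μ) with hB
  have hind : B.indicator (fun ξ : R3 => ((rho χ μ ‖(2 * Real.pi) • ξ‖ : ℝ) : ℂ) *
      productFourier m ε a b t ξ) = fun ξ : R3 => ((rho χ μ ‖(2 * Real.pi) • ξ‖ : ℝ) : ℂ) *
      productFourier m ε a b t ξ := by
    rw [Set.indicator_eq_self]
    intro ξ hξ
    by_contra hb
    rw [hB, mem_closedBall_zero_iff, not_le] at hb
    refine hξ ?_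
    beta_reduce
    rw [rho_eq_zero_of_le χ, Complex.ofReal_zero, zero_mul]
    rw [abs_norm, norm_smul, Real.norm_of_nonneg (by positivity)]
    have : 1 * ‖ξ‖ ≤ 2 * Real.pi * ‖ξ‖ :=
      mul_le_mul_of_nonneg_right (by linarith [Real.pi_gt_three]) (norm_nonneg _)
    linarith
  rw [← hind, memLp_indicator_iff_restrict measurableSet_closedBall]
  have : IsFiniteMeasure (volume.restrict B) :=
    ⟨by rw [Measure.restrict_apply_univ]; exact measure_closedBall_lt_top⟩
  exact (htop.restrict B).mono_exponent le_top

/-- The space-time `L²` norm of the interaction on the frequency side. -/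
theorem eLpNorm_interaction_sq (χ : Cutoff) (m μ ε : ℝ) (a b : L2) :
    eLpNorm (interaction χ m μ ε a b) 2 volume ^ 2 =
      ∫⁻ t : ℝ, ∫⁻ ξ : R3, ‖((rho χ μ ‖(2 * Real.pi) • ξ‖ : ℝ) : ℂ)‖ₑ ^ 2 *
        ‖productFourier m ε a b t ξ‖ₑ ^ 2 := by
  rw [eLpNorm_two_sq, Measure.volume_eq_prod, lintegral_prod _
    (((stronglyMeasurable_interaction χ m μ ε a b).measurable.enorm.pow_const 2).aemeasurable)]
  refine lintegral_congr fun t => ?_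
  have e : (fun x => interaction χ m μ ε a b (t, x)) =
      𝓕⁻ (fun ξ : R3 => ((rho χ μ ‖(2 * Real.pi) • ξ‖ : ℝ) : ℂ) *
        productFourier m ε a b t ξ) := by
    ext x
    rw [interaction, freqProjL1, fourier_propagator_mul]
  calc ∫⁻ x, ‖interaction χ m μ ε a b (t, x)‖ₑ ^ 2
      = eLpNorm (fun x => interaction χ m μ ε a b (t, x)) 2 volume ^ 2 := (eLpNorm_two_sq _ _).symm
    _ = _ := by
        rw [e, eLpNorm_fourierInv
          (memLp_one_iff_integrable.1 (memLp_rho_mul_productFourier χ m μ ε a b t 1))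
          (memLp_rho_mul_productFourier χ m μ ε a b t 2), eLpNorm_two_sq]
        simp_rw [enorm_mul, mul_pow]

theorem lintegral_enorm_fourier_sq (a : L2) : ∫⁻ η, ‖(𝓕 a : L2) η‖ₑ ^ 2 = ‖a‖ₑ ^ 2 := by
  rw [← eLpNorm_two_sq, ← Lp.enorm_def, ← ofReal_norm, Lp.norm_fourier_eq, ofReal_norm]

/-- Reduction of the estimate for the interaction to the frequency side. -/
theorem interaction_estimate {χ : Cutoff} {m μ ε : ℝ} {a b : L2} {B : ℝ} (hB : 0 ≤ B)
    (h : eLpNorm (interaction χ m μ ε a b) 2 volume ^ 2 ≤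
      ENNReal.ofReal (B ^ 2) * (‖a‖ₑ ^ 2 * ‖b‖ₑ ^ 2)) :
    MemLp (interaction χ m μ ε a b) 2 volume ∧
      eLpNorm (interaction χ m μ ε a b) 2 volume ≤ ENNReal.ofReal (B * ‖a‖ * ‖b‖) := by
  have h2 : eLpNorm (interaction χ m μ ε a b) 2 volume ≤ ENNReal.ofReal (B * ‖a‖ * ‖b‖) := by
    refine (ENNReal.pow_le_pow_left_iff two_ne_zero).1 (h.trans (le_of_eq ?_))
    rw [ENNReal.ofReal_mul (by positivity), ENNReal.ofReal_mul hB, ofReal_norm, ofReal_norm,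
      mul_pow, mul_pow, ENNReal.ofReal_pow hB, mul_assoc]
  exact ⟨⟨(stronglyMeasurable_interaction χ m μ ε a b).aestronglyMeasurable,
    h2.trans_lt ENNReal.ofReal_lt_top⟩, h2⟩

end Interaction

/-! ### The (++) and (+−) estimates and the vanishing cases -/

section Estimates

theorem enorm_rho_sq_le {χ : Cutoff} {C : ℝ} (hC0 : 0 ≤ C) (hC : ∀ l s, |rho χ l s| ≤ C)
    (l s : ℝ) : ‖((rho χ l s : ℝ) : ℂ)‖ₑ ^ 2 ≤ ENNReal.ofReal (C ^ 2) := by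
  rw [ENNReal.ofReal_pow hC0, ← ofReal_norm, Complex.norm_real, Real.norm_eq_abs]
  gcongr
  exact hC l s

/-- The `(++)` interaction, with low output frequency. -/
theorem eLpNorm_interaction_one_sq_le {χ : Cutoff} {C : ℝ} (hC0 : 0 ≤ C)
    (hC : ∀ l s, |rho χ l s| ≤ C) {m μ l : ℝ} (hm : 0 ≤ m) (hμ : 0 < μ) (hμl : 20 * μ ≤ l)
    (hl : 1 < l) (z : Fin 3 → ℤ) (f b : L2) :
    eLpNorm (interaction χ m μ 1 (localized χ μ l z f) b) 2 volume ^ 2 ≤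
      ENNReal.ofReal (C ^ 2 * (2 * Real.pi * (8 * (m + 6) * μ ^ 2))) *
        (‖localized χ μ l z f‖ₑ ^ 2 * ‖b‖ₑ ^ 2) := by
  set a := localized χ μ l z f with ha
  -- `ρ_μ` vanishes off `X`, and on `X` the output frequency is at most `2μ ≤ l/10`, small enough
  -- for transversality.
  set X : Set R3 := {ξ | ‖(2 * Real.pi) • ξ‖ ≤ 2 * μ} with hXdef
  have hX : MeasurableSet X := measurableSet_le (by fun_prop) measurable_const
  have hw : Measurable fun p : ℝ × R3 => ‖productFourier m 1 a b p.1 p.2‖ₑ ^ 2 :=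
    (stronglyMeasurable_productFourier m 1 a b).measurable.enorm.pow_const 2
  rw [eLpNorm_interaction_sq]
  have h1 : ∀ t, ∫⁻ ξ : R3, ‖((rho χ μ ‖(2 * Real.pi) • ξ‖ : ℝ) : ℂ)‖ₑ ^ 2 *
      ‖productFourier m 1 a b t ξ‖ₑ ^ 2 ≤
      ENNReal.ofReal (C ^ 2) * ∫⁻ ξ in X, ‖productFourier m 1 a b t ξ‖ₑ ^ 2 := by
    intro t
    rw [← lintegral_const_mul' _ _ ENNReal.ofReal_ne_top, ← lintegral_indicator hX]
    refine lintegral_mono fun ξ => ?_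
    by_cases hξ : ξ ∈ X
    · rw [Set.indicator_of_mem hξ]
      exact mul_le_mul_left (enorm_rho_sq_le hC0 hC _ _) _
    · rw [Set.indicator_of_notMem hξ, rho_eq_zero_of_le χ]
      · simp
      · rw [abs_norm]
        exact (not_le.1 hξ).le
  refine (lintegral_mono h1).trans ?_
  rw [lintegral_const_mul' _ _ ENNReal.ofReal_ne_top, lintegral_lintegral_swap hw.aemeasurable,
    ENNReal.ofReal_mul (by positivity), mul_assoc, ← lintegral_enorm_fourier_sq a,
    ← lintegral_enorm_fourier_sq b]
  refine mul_le_mul_right ?_ _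
  refine lintegral_bilinear_oscIntegral_le (A := {η | (2 * Real.pi) • η ∈ shellCube μ l z})
    (Lp.memLp _) (Lp.memLp _) (measurable_bracketSum m 1)
    ((measurableSet_shellCube μ l z).preimage (measurable_const_smul _)) hX
    (fourier_localized_eq_zero χ hl z f) (by positivity) fun ξ hξ x y hxy => ?_
  have h := volume_level_low_output_le (z := z) hm hμ hμl hl.le hxy hξ
  simpa only [bracketSum, smul_sub, one_mul, Set.mem_ofPred_eq] using h

/-- The product of a wave packet with itself. -/
theorem lintegral_productFourier_self_le {χ : Cutoff} {m μ l : ℝ} (hm : 0 ≤ m) (hμ : 0 < μ)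
    (hμl : 20 * μ ≤ l) (hl : 1 < l) (z : Fin 3 → ℤ) (f : L2) :
    ∫⁻ t : ℝ, ∫⁻ ξ : R3, ‖productFourier m 1 (localized χ μ l z f) (localized χ μ l z f) t ξ‖ₑ ^ 2 ≤
      ENNReal.ofReal (2 * Real.pi * (128 * Real.pi * (m + 6) ^ 3 * (μ * l))) *
        (‖localized χ μ l z f‖ₑ ^ 2 * ‖localized χ μ l z f‖ₑ ^ 2) := by
  set a := localized χ μ l z f with ha
  have hl0 : 0 < l := by linarith
  have hw : Measurable fun p : ℝ × R3 => ‖productFourier m 1 a a p.1 p.2‖ₑ ^ 2 :=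
    (stronglyMeasurable_productFourier m 1 a a).measurable.enorm.pow_const 2
  rw [lintegral_lintegral_swap hw.aemeasurable, ← lintegral_enorm_fourier_sq a,
    ← setLIntegral_univ]
  refine lintegral_bilinear_oscIntegral_le (A := {η | (2 * Real.pi) • η ∈ shellCube μ l z})
    (Lp.memLp _) (Lp.memLp _) (measurable_bracketSum m 1)
    ((measurableSet_shellCube μ l z).preimage (measurable_const_smul _)) MeasurableSet.univ
    (fourier_localized_eq_zero χ hl z f) (by positivity) fun ξ _ x y hxy => ?_
  -- The square of a packet lives near twice its frequency, not at `|ξ| ≲ μ`, so the curvature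
  -- bound, valid for all `ξ`, replaces transversality.
  have h := volume_level_le (z := z) hm hμ hμl hl.le hxy ((2 * Real.pi) • ξ)
  simpa only [bracketSum, smul_sub, one_mul, Set.mem_ofPred_eq] using h

theorem lintegral_mul_le_sqrt {α : Type*} [MeasurableSpace α] {ν : Measure α} {f g : α → ℝ≥0∞}
    (hf : AEMeasurable f ν) (hg : AEMeasurable g ν) :
    ∫⁻ x, f x * g x ∂ν ≤
      (∫⁻ x, f x ^ 2 ∂ν) ^ (1 / 2 : ℝ) * (∫⁻ x, g x ^ 2 ∂ν) ^ (1 / 2 : ℝ) := by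
  have h := ENNReal.lintegral_mul_le_Lp_mul_Lq ν Real.HolderConjugate.two_two hf hg
  simpa using h

/-- Cauchy-Schwarz in space: the product of two waves with integrable Fourier transforms. -/
theorem lintegral_productFourier_sq_le (m ε : ℝ) {a b : L2} (ha : Integrable (𝓕 a : L2))
    (hb : Integrable (𝓕 b : L2)) (t : ℝ) :
    ∫⁻ ξ : R3, ‖productFourier m ε a b t ξ‖ₑ ^ 2 ≤
      (∫⁻ ξ : R3, ‖productFourier m 1 a a t ξ‖ₑ ^ 2) ^ (1 / 2 : ℝ) *
        (∫⁻ ξ : R3, ‖productFourier m 1 b b (ε * t) ξ‖ₑ ^ 2) ^ (1 / 2 : ℝ) := by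
  -- Boundedness of the waves puts their products in `L²`, as Plancherel requires.
  have hprop : ∀ (s : ℝ) {c : L2}, Integrable (𝓕 c : L2) → MemLp (propagator m s c) ∞ volume := by
    intro s c hc
    refine memLp_top_of_integrable_fourier ((hc.bdd_mul (c := 1) ?_
      (Filter.Eventually.of_forall fun ξ => ?_)).congr (coeFn_fourier_propagator m s c).symm)
    · exact ((measurable_prop_symbol m s).comp (measurable_const_smul _)).aestronglyMeasurable
    · exact (norm_exp_neg_I_mul _).le
  have hpl : ∀ (ε s : ℝ) {c d : L2}, Integrable (𝓕 c : L2) → Integrable (𝓕 d : L2) →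
      ∫⁻ ξ : R3, ‖productFourier m ε c d s ξ‖ₑ ^ 2 =
        ∫⁻ x, ‖propagator m s c x‖ₑ ^ 2 * ‖propagator m (ε * s) d x‖ₑ ^ 2 := by
    intro ε s c d hc hd
    have h1 : Integrable fun x => propagator m s c x * propagator m (ε * s) d x :=
      (Lp.memLp (propagator m s c)).integrable_mul (Lp.memLp (propagator m (ε * s) d))
    have h2 : MemLp (fun x => propagator m s c x * propagator m (ε * s) d x) 2 volume :=
      (Lp.memLp (propagator m (ε * s) d)).mul (hprop s hc)
    rw [← eLpNorm_two_sq, ← fourier_propagator_mul, eLpNorm_fourier h1 h2, eLpNorm_two_sq]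
    simp_rw [enorm_mul, mul_pow]
  rw [hpl ε t ha hb, hpl 1 t ha ha, hpl 1 (ε * t) hb hb]
  simp_rw [one_mul, ← sq]
  exact lintegral_mul_le_sqrt ((Lp.aestronglyMeasurable _).enorm.pow_const 2)
    ((Lp.aestronglyMeasurable _).enorm.pow_const 2)

theorem integrable_fourier_localized (χ : Cutoff) (μ l : ℝ) (z : Fin 3 → ℤ) (f : L2) :
    Integrable (𝓕 (localized χ μ l z f) : L2) :=
  integrable_of_ae_eq_zero_off_ball (fourier_localized_eq_zero_of_large χ μ l z f)

/-- The `(+-)` interaction, through the `L⁴` norms of the two waves. -/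
theorem eLpNorm_interaction_neg_one_sq_le {χ : Cutoff} {C : ℝ} (hC0 : 0 ≤ C)
    (hC : ∀ l s, |rho χ l s| ≤ C) {m μ l₁ l₂ Λ : ℝ} (hm : 0 ≤ m) (hμ : 0 < μ)
    (hμl₁ : 20 * μ ≤ l₁) (hl₁ : 1 < l₁) (hμl₂ : 20 * μ ≤ l₂) (hl₂ : 1 < l₂) (hΛ₁ : l₁ ≤ Λ)
    (hΛ₂ : l₂ ≤ Λ) (z z' : Fin 3 → ℤ) (f g : L2) :
    eLpNorm (interaction χ m μ (-1) (localized χ μ l₁ z f) (localized χ μ l₂ z' g)) 2 volume ^ 2 ≤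
      ENNReal.ofReal (C ^ 2 * (2 * Real.pi * (128 * Real.pi * (m + 6) ^ 3 * (μ * Λ)))) *
        (‖localized χ μ l₁ z f‖ₑ ^ 2 * ‖localized χ μ l₂ z' g‖ₑ ^ 2) := by
  have hself : ∀ {l : ℝ} (w : Fin 3 → ℤ) (h : L2), 20 * μ ≤ l → 1 < l → l ≤ Λ →
      ∫⁻ t : ℝ, ∫⁻ ξ : R3,
        ‖productFourier m 1 (localized χ μ l w h) (localized χ μ l w h) t ξ‖ₑ ^ 2 ≤
      ENNReal.ofReal (2 * Real.pi * (128 * Real.pi * (m + 6) ^ 3 * (μ * Λ))) *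
        (‖localized χ μ l w h‖ₑ ^ 2) ^ 2 := by
    intro l w h h1 h2 h3
    refine (lintegral_productFourier_self_le hm hμ h1 h2 w h).trans ?_
    rw [sq (‖localized χ μ l w h‖ₑ ^ 2)]
    gcongr
  have hA := hself z f hμl₁ hl₁ hΛ₁
  have hB := hself z' g hμl₂ hl₂ hΛ₂
  have hia := integrable_fourier_localized χ μ l₁ z f
  have hib := integrable_fourier_localized χ μ l₂ z' g
  set a := localized χ μ l₁ z f
  set b := localized χ μ l₂ z' g
  set M := ENNReal.ofReal (2 * Real.pi * (128 * Real.pi * (m + 6) ^ 3 * (μ * Λ))) with hM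
  set A : ℝ → ℝ≥0∞ := fun t => ∫⁻ ξ : R3, ‖productFourier m 1 a a t ξ‖ₑ ^ 2 with hAdef
  set B : ℝ → ℝ≥0∞ := fun t => ∫⁻ ξ : R3, ‖productFourier m 1 b b t ξ‖ₑ ^ 2 with hBdef
  have hAm : Measurable A :=
    ((stronglyMeasurable_productFourier m 1 a a).measurable.enorm.pow_const 2).lintegral_prod_right'
  have hBm : Measurable B :=
    ((stronglyMeasurable_productFourier m 1 b b).measurable.enorm.pow_const 2).lintegral_prod_right'
  -- The second wave runs backwards in time; its self-interaction norm is invariant under `t ↦ -t`.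
  have hB' : ∫⁻ t, B (-1 * t) ≤ M * (‖b‖ₑ ^ 2) ^ 2 := by
    simp_rw [neg_one_mul]
    exact (lintegral_neg_eq_self B).trans_le hB
  have hsq : ∀ r : ℝ≥0∞, (r ^ (1 / 2 : ℝ)) ^ 2 = r := fun r => by
    rw [← ENNReal.rpow_natCast, ← ENNReal.rpow_mul]
    norm_num
  have hsq' : ∀ r : ℝ≥0∞, (r ^ 2) ^ (1 / 2 : ℝ) = r := fun r => by
    rw [← ENNReal.rpow_natCast, ← ENNReal.rpow_mul]
    norm_num
  rw [eLpNorm_interaction_sq, ENNReal.ofReal_mul (by positivity), mul_assoc, ← hM]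
  calc _ ≤ ∫⁻ t : ℝ, ENNReal.ofReal (C ^ 2) *
        (A t ^ (1 / 2 : ℝ) * B (-1 * t) ^ (1 / 2 : ℝ)) := by
        refine lintegral_mono fun t => ?_
        refine le_trans ?_ (mul_le_mul_right (lintegral_productFourier_sq_le m (-1) hia hib t) _)
        rw [← lintegral_const_mul' _ _ ENNReal.ofReal_ne_top]
        exact lintegral_mono fun ξ => mul_le_mul_left (enorm_rho_sq_le hC0 hC _ _) _
    _ = ENNReal.ofReal (C ^ 2) * ∫⁻ t : ℝ, A t ^ (1 / 2 : ℝ) * B (-1 * t) ^ (1 / 2 : ℝ) :=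
        lintegral_const_mul' _ _ ENNReal.ofReal_ne_top
    _ ≤ _ := by
        refine mul_le_mul_right ?_ _
        -- Cauchy–Schwarz in time, completing the one already made in space.
        refine (lintegral_mul_le_sqrt (hAm.pow_const _).aemeasurable
          ((hBm.comp (measurable_const_mul (-1))).pow_const _).aemeasurable).trans ?_
        simp_rw [hsq, Function.comp_apply]
        calc _ ≤ (M * (‖a‖ₑ ^ 2) ^ 2) ^ (1 / 2 : ℝ) * (M * (‖b‖ₑ ^ 2) ^ 2) ^ (1 / 2 : ℝ) := by
              gcongr
          _ = _ := by
              rw [← ENNReal.mul_rpow_of_nonneg _ _ (by norm_num),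
                show M * (‖a‖ₑ ^ 2) ^ 2 * (M * (‖b‖ₑ ^ 2) ^ 2) =
                  (M * (‖a‖ₑ ^ 2 * ‖b‖ₑ ^ 2)) ^ 2 by ring, hsq']

/-- The output at frequency `≲ μ` vanishes if the second input has frequency `≲ μ` but the first
one does not. -/
theorem eLpNorm_interaction_eq_zero {χ : Cutoff} {m μ l₁ l₂ : ℝ} (ε : ℝ) (hμ : 0 < μ)
    (hμl₁ : 100 * μ ≤ l₁) (hl₁ : 1 < l₁) (hl₂ : l₂ < 20 * μ) (z z' : Fin 3 → ℤ) (f g : L2) :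
    eLpNorm (interaction χ m μ ε (localized χ μ l₁ z f) (localized χ μ l₂ z' g)) 2 volume ^ 2 =
      0 := by
  rw [eLpNorm_interaction_sq]
  refine (lintegral_congr fun t => (lintegral_congr fun ξ => ?_).trans lintegral_zero).trans
    lintegral_zero
  rcases le_or_gt (2 * μ) ‖(2 * Real.pi) • ξ‖ with h | h
  · rw [rho_eq_zero_of_le χ (by rwa [abs_norm])]
    simp
  · have : productFourier m ε (localized χ μ l₁ z f) (localized χ μ l₂ z' g) t ξ = 0 := by
      refine integral_eq_zero_of_ae ?_
      filter_upwards [fourier_localized_eq_zero χ hl₁ z f,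
        (measurePreserving_sub_left_volume ξ).quasiMeasurePreserving.ae
          (fourier_localized_eq_zero_of_large χ μ l₂ z' g)] with η h1 h2
      -- `‖2πη‖ ≥ l₁/2 ≥ 50μ` and `‖2πξ‖ < 2μ` put the second input above frequency `48μ`, beyond
      -- its support radius `2l₂ < 40μ`.
      by_cases hη : (2 * Real.pi) • η ∈ shellCube μ l₁ z
      · rw [h2 ?_, mul_zero, mul_zero]
        · rfl
        · rw [smul_sub]
          have h3 := norm_sub_norm_le ((2 * Real.pi) • η) ((2 * Real.pi) • ξ)
          rw [norm_sub_rev] at h3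
          linarith [hη.2.1]
      · rw [h1 hη, zero_mul, mul_zero]
        rfl
    rw [this]
    simp

/-- The output vanishes below frequency one. -/
theorem eLpNorm_interaction_eq_zero_of_lt_one (χ : Cutoff) (m ε : ℝ) {μ : ℝ} (hμ : μ < 1)
    (a b : L2) : eLpNorm (interaction χ m μ ε a b) 2 volume ^ 2 = 0 := by
  rw [eLpNorm_interaction_sq]
  refine (lintegral_congr fun t => (lintegral_congr fun ξ => ?_).trans lintegral_zero).trans
    lintegral_zero
  rw [rho, if_pos hμ]
  simp

end Estimates

end DiracBilinear

end

/-! ### Choice of constants and conclusion -/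

theorem lemma8p1 :
    ∃ N : ℝ, 1 < N ∧
      ∀ (χ : DiracBilinear.Cutoff) (m : ℝ), 0 ≤ m → ∀ K : ℝ, 1 ≤ K →
        ∃ C : ℝ, 0 < C ∧
          ∀ μ l₁ l₂ : ℝ, DiracBilinear.IsDyadic μ → DiracBilinear.IsDyadic l₁ →
            DiracBilinear.IsDyadic l₂ →
            N * μ ≤ l₁ → l₁ ≤ K * l₂ → l₂ ≤ K * l₁ →
            ∀ (z z' : Fin 3 → ℤ) (f g : DiracBilinear.L2),
              (MemLp (DiracBilinear.interaction χ m μ 1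
                    (DiracBilinear.localized χ μ l₁ z f)
                    (DiracBilinear.localized χ μ l₂ z' g)) 2 volume ∧
                eLpNorm (DiracBilinear.interaction χ m μ 1
                    (DiracBilinear.localized χ μ l₁ z f)
                    (DiracBilinear.localized χ μ l₂ z' g)) 2 volume ≤
                  ENNReal.ofReal (C * μ * ‖DiracBilinear.localized χ μ l₁ z f‖ *
                    ‖DiracBilinear.localized χ μ l₂ z' g‖)) ∧
              (MemLp (DiracBilinear.interaction χ m μ (-1)
                    (DiracBilinear.localized χ μ l₁ z f)
                    (DiracBilinear.localized χ μ l₂ z' g)) 2 volume ∧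
                eLpNorm (DiracBilinear.interaction χ m μ (-1)
                    (DiracBilinear.localized χ μ l₁ z f)
                    (DiracBilinear.localized χ μ l₂ z' g)) 2 volume ≤
                  ENNReal.ofReal (C * (μ * l₁) ^ (1 / 2 : ℝ) *
                    ‖DiracBilinear.localized χ μ l₁ z f‖ *
                    ‖DiracBilinear.localized χ μ l₂ z' g‖)) := by
  -- `N = 100` ensures `20μ ≤ l₁` and gives the frequency gap needed when `l₂ < 20μ`.
  refine ⟨100, by norm_num, fun χ m hm K hK => ?_⟩
  obtain ⟨R, hR1, hR⟩ := χ.exists_rho_bound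
  have hR0 : 0 ≤ R := by linarith
  have hK0 : 0 < K := by linarith
  -- The square of the constant, dictated by (+−): the factor `K` comes from bounding both
  -- frequencies by `K l₁`. It also absorbs the smaller (++) constant.
  set D : ℝ := R ^ 2 * (2 * Real.pi * (128 * Real.pi * (m + 6) ^ 3 * K)) with hD
  have hD0 : 0 < D := by positivity
  refine ⟨Real.sqrt D, Real.sqrt_pos.2 hD0, ?_⟩
  rintro μ l₁ l₂ ⟨k, rfl⟩ - - hN - hl₂K z z' f g
  set μ : ℝ := (2 : ℝ) ^ k
  have hμ : 0 < μ := by positivity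
  have hl₁0 : 0 < l₁ := by linarith
  have hroot : (μ * l₁) ^ (1 / 2 : ℝ) = Real.sqrt (μ * l₁) := (Real.sqrt_eq_rpow _).symm
  rw [hroot]
  -- For `μ < 1` the output projection is zero; otherwise `l₁ ≥ 100`, so `ρ_{l₁}` is supported in a
  -- genuine shell away from the origin.
  rcases lt_or_ge μ 1 with hμ1 | hμ1
  · constructor <;> refine DiracBilinear.interaction_estimate (by positivity) ?_ <;>
      rw [DiracBilinear.eLpNorm_interaction_eq_zero_of_lt_one χ m _ hμ1] <;> exact zero_le
  have hl₁1 : 1 < l₁ := by linarith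
  constructor
  · refine DiracBilinear.interaction_estimate (by positivity) ?_
    refine (DiracBilinear.eLpNorm_interaction_one_sq_le hR0 hR hm hμ (by linarith) hl₁1 z f
      _).trans ?_
    gcongr
    rw [mul_pow, Real.sq_sqrt hD0.le, hD, mul_assoc (R ^ 2), mul_assoc (2 * Real.pi)]
    gcongr ?_ * (?_ * ?_)
    have h1 : m + 6 ≤ (m + 6) ^ 3 := le_self_pow₀ (by linarith) (by norm_num)
    have h2 : 8 ≤ 128 * Real.pi := by linarith [Real.pi_gt_three]
    rw [show 128 * Real.pi * (m + 6) ^ 3 * K * μ ^ 2 =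
      (128 * Real.pi) * (m + 6) ^ 3 * μ ^ 2 * K by ring]
    refine le_trans ?_ (le_mul_of_one_le_right (by positivity) hK)
    gcongr
  · refine DiracBilinear.interaction_estimate (by positivity) ?_
    -- If `l₂ < 20μ` the cubes are too large for the `L⁴` argument on `g`, but then the output
    -- vanishes.
    rcases lt_or_ge l₂ (20 * μ) with h20 | h20
    · rw [DiracBilinear.eLpNorm_interaction_eq_zero (-1) hμ hN hl₁1 h20 z z' f g]
      exact zero_le
    refine (DiracBilinear.eLpNorm_interaction_neg_one_sq_le (Λ := K * l₁) hR0 hR hm hμ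
      (by linarith) hl₁1 h20 (by linarith) (le_mul_of_one_le_left hl₁0.le hK) hl₂K z z' f
      g).trans (le_of_eq ?_)
    rw [mul_pow, Real.sq_sqrt hD0.le, Real.sq_sqrt (by positivity), hD]
    congr 2
    ring
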